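/- Let $G=(V,E,w)$ be a finite simple undirected graph with finite nonnegative edge weights (unweighted graphs being the case $w\equiv 1$), and let $\mathrm{dist}_G$ be its shortest-path distance, with value $\infty$ between different components. For a graph $H=(V,E_H)$ on the same vertex set (not necessarily a subgraph of $G$), $H$ is a *$t$-emulator* of $G$ if, when each edge $\{a,b\}\in E_H$ is given weight $\mathrm{dist}_G(a,b)$, $$\mathrm{dist}_G(u,v)\le \mathrm{dist}_H(u,v)\le t\cdot \mathrm{dist}_G(u,v)\qquad\text{for all }u,v\in V .$$ $H$ is an *$f$-edge-fault-tolerant ($f$-EFT) $t$-emulator* of $G$ if for every $F\subseteq E$ with $|F|\le f$, $H$ is a $t$-emulator of $G\setminus F$ (so the edges of $H$ are unchanged, but are reweighted by $\mathrm{dist}_{G\setminus F}$). 1. For every constant $C$ there is a constant $K$, depending only on $C$, such that for every $n$, every $n$-node weighted graph $G$ and every integer $f\ge 0$ with $f\le C n^{2/9}$, there is an $f$-EFT $5$-emulator $H$ of $G$ with $|E(H)|\le K n^{4/3}$. 2. For every odd positive integer $k$ and every constant $C$ there is a constant $K$, depending only on $k$ and $C$, such that for every $n$, every $n$-node weighted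 graph $G$ and every integer $f\ge 0$ with $f\le C n^{2/(k(k+1))}$, there is an $f$-EFT $(2k-1)$-emulator $H$ of $G$ with $|E(H)|\le K n^{1+1/k}$. -/

import Mathlib

open scoped NNReal ENNReal

universe u

namespace EFT

/-- Total weight of a walk, where `w e` is the weight of the edge `e`. -/
noncomputable def walkWeight {V : Type u} {G : SimpleGraph V} (w : Sym2 V → ℝ≥0∞) {a b : V}
    (p : G.Walk a b) : ℝ≥0∞ :=
  (p.edges.map w).sum

/-- Shortest-path distance from `a` to `b` in the graph `G` with edge weights `w`; it is `∞` when
`b` is not reachable from `a`. Only the values of `w` on edges of `G` matter. -/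
noncomputable def wdist {V : Type u} (G : SimpleGraph V) (w : Sym2 V → ℝ≥0∞) (a b : V) : ℝ≥0∞ :=
  ⨅ p : G.Walk a b, walkWeight w p

theorem wdist_comm {V : Type u} (G : SimpleGraph V) (w : Sym2 V → ℝ≥0∞) (a b : V) :
    wdist G w a b = wdist G w b a := by
  have h : ∀ x y : V, wdist G w x y ≤ wdist G w y x := fun x y =>
    le_iInf fun p => (iInf_le _ p.reverse).trans (le_of_eq (by
      simp [walkWeight, SimpleGraph.Walk.edges_reverse, List.map_reverse, List.sum_reverse]))
  exact le_antisymm (h a b) (h b a)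

/-- The weight function of an emulator of `(G, w)`: the pair `{a, b}` has weight
`dist_G(a, b)`. -/
noncomputable def emulatorWeight {V : Type u} (G : SimpleGraph V) (w : Sym2 V → ℝ≥0∞) :
    Sym2 V → ℝ≥0∞ :=
  Sym2.lift ⟨wdist G w, wdist_comm G w⟩

/-- `H` is a `t`-emulator of the weighted graph `(G, w)`: when each edge `{a, b}` of `H` gets
weight `dist_G(a, b)`, one has `dist_G(a, b) ≤ dist_H(a, b) ≤ t * dist_G(a, b)` for all vertices
`a, b`. The graph `H` need not be a subgraph of `G`. -/
def IsEmulator {V : Type u} (G : SimpleGraph V) (w : Sym2 V → ℝ≥0∞) (t : ℝ≥0)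
    (H : SimpleGraph V) : Prop :=
  ∀ a b : V, wdist G w a b ≤ wdist H (emulatorWeight G w) a b ∧
    wdist H (emulatorWeight G w) a b ≤ (t : ℝ≥0∞) * wdist G w a b

/-- `H` is an `f`-edge-fault-tolerant `t`-emulator of the graph `G` with finite nonnegative edge
weights `w`: for every set `F` of at most `f` edges of `G`, `H` is a `t`-emulator of `G \ F`. The
edge set of `H` is not changed by the faults; only its weights are. -/
def IsEFTEmulator {V : Type u} (G : SimpleGraph V) (w : Sym2 V → ℝ≥0) (f : ℕ) (t : ℝ≥0)
    (H : SimpleGraph V) : Prop :=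
  ∀ F : Finset (Sym2 V), (F : Set (Sym2 V)) ⊆ G.edgeSet → F.card ≤ f →
    IsEmulator (G.deleteEdges (F : Set (Sym2 V))) (fun e => (w e : ℝ≥0∞)) t H

end EFT

/-! Write `k = 2 * r + 1`, so that the stretch is `4 * r + 1`. A greedy algorithm runs through the
edges of `G` by weight and keeps `e` if some set of at most `f` faults, not containing `e`, makes
the edges kept so far fail for `e`. The result is an emulator by construction; the work is to count
its edges. The count uses only the two properties in `FaultConfig`. Lighter detours around `e` with
at most `4 * r + 1` edges meet the faults of `e`. Those with at most `2 * r + 1` edges meet them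
twice, and this is where emulators beat spanners: a single faulty edge `g` of the detour stays in
`H`, and `G \ F` bypasses it through `e` and the rest of the detour (`isObstruction_hit_twice`).

Let `q` be the number of edges per vertex. After splitting vertices the degrees are at most `q`
(`exists_bounded_degree`). From both ends of a typical edge `e` grow arms: descending walks of `r`
edges that avoid the faults of `e` and whose edges are pairwise unrelated through faults. Such walks
are determined by their ends (`clean_unique`), so `e` has of order `q ^ (2 * r)` pairs of arm ends
(`exists_arm_ends`). If a lighter edge `e'` has the same pair, a detour of `4 * r + 1` edges closes
up, so either an arm of `e'` contains a fault of `e`, or `e'` is one. By `card_repeated_pairs_le`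
such pairs number `O(f * q ^ (2 * r - 1) + f ^ (2 * r + 1) * q ^ (2 * r - 2))` for `f ≥ 1`, a small
share of all pairs once `q ^ 2` is large against `f ^ k`. The other pairs are distinct for distinct
edges, whence `n * q * q ^ (2 * r) = O(n ^ 2)` and `q = O(n ^ (1 / k))`. In the remaining case `q ^
2 = O((f + 1) ^ k)`, which gives the same bound if `f = O(n ^ (2 / k ^ 2))`.

For `k = 3` the exponent is `2 / 9`, and in general `2 / (k * (k + 1)) ≤ 2 / k ^ 2`. For `k = 1` the
complete graph serves. -/

namespace EFT

/-! ### Fault configurations and clean walks -/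

/-- A graph whose edges are ranked and carry sets of at most `f` faulty edges, such that every
lighter detour around an edge `e` of length at most `4 * r + 1` meets the faults of `e`, and every
lighter detour of length at most `2 * r + 1` meets them at least twice. -/
structure FaultConfig {V : Type u} (X : SimpleGraph V) (r f : ℕ) where
  rank : Sym2 V → ℕ
  rank_inj : Set.InjOn rank X.edgeSet
  F : Sym2 V → Finset (Sym2 V)
  card_F : ∀ e, (F e).card ≤ f
  notMem_F : ∀ e, e ∉ F e
  hit : ∀ x y, X.Adj x y → ∀ p : X.Walk x y, (∀ g ∈ p.edges, rank g < rank s(x, y)) →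
    p.length ≤ 4 * r + 1 → ∃ g ∈ p.edges, g ∈ F s(x, y)
  hit_twice : ∀ x y, X.Adj x y → ∀ p : X.Walk x y, (∀ g ∈ p.edges, rank g < rank s(x, y)) →
    p.length ≤ 2 * r + 1 → ∃ g ∈ p.edges, ∃ h ∈ p.edges, g ≠ h ∧ g ∈ F s(x, y) ∧ h ∈ F s(x, y)

namespace FaultConfig

variable {V : Type u} {X : SimpleGraph V} {r f : ℕ} (c : FaultConfig X r f)

/-- Two edges are related if one is a fault of the other, or both are faults of the same edge. -/
def Rel (g h : Sym2 V) : Prop :=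
  g ∈ c.F h ∨ h ∈ c.F g ∨ ∃ e ∈ X.edgeSet, g ∈ c.F e ∧ h ∈ c.F e

theorem Rel.symm {g h : Sym2 V} (H : c.Rel g h) : c.Rel h g := by
  rcases H with H | H | ⟨e, he, H, H'⟩
  exacts [Or.inr (Or.inl H), Or.inl H, Or.inr (Or.inr ⟨e, he, H', H⟩)]

/-- Descending lists of pairwise unrelated edges. -/
def Clean (l : List (Sym2 V)) : Prop :=
  l.Pairwise fun g h => c.rank h < c.rank g ∧ ¬ c.Rel g h

theorem Clean.nodup {l : List (Sym2 V)} (hl : c.Clean l) : l.Nodup :=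
  List.Pairwise.imp (fun {a b} h hab => by subst hab; exact lt_irrefl _ h.1) hl

theorem Clean.not_rel {l : List (Sym2 V)} (hl : c.Clean l) {g h : Sym2 V} (hg : g ∈ l)
    (hh : h ∈ l) (hgh : g ≠ h) : ¬ c.Rel g h :=
  have : Std.Symm fun g h => ¬ c.Rel g h := ⟨fun _ _ H H' => H (Rel.symm c H')⟩
  List.Pairwise.forall (R := fun g h => ¬ c.Rel g h)
    (List.Pairwise.imp (fun h => h.2) hl) hg hh hgh

/-- The other walk followed by `p` backwards is a short lighter detour around `s(a, x)`, so it
contains two faults of that edge. Neither lies on `p`, whose edges are unrelated to `s(a, x)`. Hence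
both lie on the other clean walk, although common faults of one edge are related. -/
theorem clean_diverge {a x y s : V} (hx : X.Adj a x) (p : X.Walk x s) (hy : X.Adj a y)
    (q : X.Walk y s) (hp : c.Clean (s(a, x) :: p.edges)) (hq : c.Clean (s(a, y) :: q.edges))
    (hlt : c.rank s(a, y) < c.rank s(a, x)) (hlen : p.length + q.length ≤ 2 * r) : False := by
  have hp' := List.pairwise_cons.1 hp
  have hq' := List.pairwise_cons.1 hq
  obtain ⟨g, hg, h, hh, hgh, hgF, hhF⟩ := c.hit_twice a x hx ((q.cons hy).append p.reverse)
    (by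
      intro g hg
      simp only [SimpleGraph.Walk.edges_append, SimpleGraph.Walk.edges_cons, List.mem_append,
        List.mem_cons, SimpleGraph.Walk.edges_reverse, List.mem_reverse] at hg
      rcases hg with (rfl | hg) | hg
      · exact hlt
      · exact (hq'.1 g hg).1.trans hlt
      · exact (hp'.1 g hg).1)
    (by simp; omega)
  have key : ∀ g, g ∈ ((q.cons hy).append p.reverse).edges → g ∈ c.F s(a, x) →
      g ∈ s(a, y) :: q.edges := by
    intro g hg hgF
    simp only [SimpleGraph.Walk.edges_append, SimpleGraph.Walk.edges_cons, List.mem_append,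
      SimpleGraph.Walk.edges_reverse, List.mem_reverse] at hg
    rcases hg with hg | hg
    · exact hg
    · exact absurd (Or.inr (Or.inl hgF)) (hp'.1 g hg).2
  exact Clean.not_rel c hq (key g hg hgF) (key h hh hhF) hgh
    (Or.inr (Or.inr ⟨_, hx, hgF, hhF⟩))

/-- Clean walks of the same length, at most `r + 1`, with the same ends coincide. -/
theorem clean_unique {a s : V} (p q : X.Walk a s) (hpq : p.length = q.length)
    (hlen : p.length ≤ r + 1) (hp : c.Clean p.edges) (hq : c.Clean q.edges) : p = q := by
  induction p with
  | nil =>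
    cases q with
    | nil => rfl
    | cons => simp at hpq
  | @cons a x s hx p ih =>
    cases q with
    | nil => simp at hpq
    | @cons _ y _ hy q =>
      simp only [SimpleGraph.Walk.length_cons, SimpleGraph.Walk.edges_cons] at *
      by_cases hxy : x = y
      · subst hxy
        rw [ih q (by omega) (by omega) (List.pairwise_cons.1 hp).2 (List.pairwise_cons.1 hq).2]
      · exfalso
        have hne : s(a, x) ≠ s(a, y) := fun h => hxy (Sym2.congr_right.1 h)
        rcases lt_or_gt_of_ne (fun h => hne (c.rank_inj hx hy h)) with h | h
        · exact c.clean_diverge hy q hx p hq hp h (by omega)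
        · exact c.clean_diverge hx p hy q hp hq h (by omega)

end FaultConfig

/-! ### Splitting walks and counting reachable vertices -/

/-- A walk through an edge splits there. -/
theorem exists_split_of_mem_edges {V : Type u} {X : SimpleGraph V} {a b : V} (p : X.Walk a b)
    {g : Sym2 V} (hg : g ∈ p.edges) : ∃ (x y : V) (q : X.Walk a x) (h : X.Adj x y)
      (q' : X.Walk y b), g = s(x, y) ∧ p = q.append (q'.cons h) := by
  induction p with
  | nil => simp at hg
  | @cons a x b h p ih =>
    rcases List.mem_cons.1 (by simpa using hg) with rfl | hg
    · exact ⟨a, x, .nil, h, p, rfl, rfl⟩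
    · obtain ⟨y, z, q, h', q', rfl, rfl⟩ := ih hg
      exact ⟨y, z, q.cons h, h', q', rfl, rfl⟩

/-- A walk entering a set splits at an entry. -/
theorem exists_split_of_enter {V : Type u} {X : SimpleGraph V} {a b : V} (p : X.Walk a b)
    (Z : Set V) (ha : a ∉ Z) (hb : b ∈ Z) : ∃ (x y : V) (q : X.Walk a x) (h : X.Adj x y)
      (q' : X.Walk y b), x ∉ Z ∧ y ∈ Z ∧ p = q.append (q'.cons h) := by
  induction p with
  | nil => exact absurd hb ha
  | @cons a x b h p ih =>
    by_cases hx : x ∈ Z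
    · exact ⟨a, x, .nil, h, p, ha, hx, rfl⟩
    · obtain ⟨y, z, q, h', q', hy, hz, rfl⟩ := ih hx hb
      exact ⟨y, z, q.cons h, h', q', hy, hz, rfl⟩

open Classical in
/-- The vertices at the end of a walk of length `l` from `a`. -/
noncomputable def reach {V : Type u} [Fintype V] (X : SimpleGraph V) (l : ℕ) (a : V) : Finset V :=
  Finset.univ.filter fun b => ∃ p : X.Walk a b, p.length = l

theorem mem_reach {V : Type u} [Fintype V] {X : SimpleGraph V} {a b : V} (p : X.Walk a b) :
    b ∈ reach X p.length a := by
  classical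
  simp only [reach, Finset.mem_filter, Finset.mem_univ, true_and]
  exact ⟨p, rfl⟩

theorem card_reach_le {V : Type u} [Fintype V] {X : SimpleGraph V} {Δ : ℕ}
    (hΔ : ∀ v, (X.neighborSet v).ncard ≤ Δ) (l : ℕ) (a : V) : (reach X l a).card ≤ Δ ^ l := by
  classical
  induction l generalizing a with
  | zero =>
    refine Finset.card_le_one.2 ?_
    intro x hx y hy
    simp only [reach, Finset.mem_filter, Finset.mem_univ, true_and] at hx hy
    obtain ⟨p, hp⟩ := hx
    obtain ⟨q, hq⟩ := hy
    rw [← SimpleGraph.Walk.eq_of_length_eq_zero hp, SimpleGraph.Walk.eq_of_length_eq_zero hq]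
  | succ l ih =>
    have hsub : reach X (l + 1) a ⊆ (X.neighborFinset a).biUnion (reach X l) := by
      intro b hb
      simp only [reach, Finset.mem_filter, Finset.mem_univ, true_and] at hb
      obtain ⟨p, hp⟩ := hb
      cases p with
      | nil => simp at hp
      | @cons _ x _ h p =>
        have : p.length = l := by simpa using hp
        exact Finset.mem_biUnion.2 ⟨x, by simpa using h, this ▸ mem_reach p⟩
    calc _ ≤ _ := Finset.card_le_card hsub
      _ ≤ (X.neighborFinset a).card * Δ ^ l := Finset.card_biUnion_le_card_mul _ _ _ fun x _ => ih x
      _ ≤ Δ * Δ ^ l := by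
        gcongr
        rw [← Set.ncard_coe_finset, SimpleGraph.coe_neighborFinset]
        exact hΔ a
      _ = Δ ^ (l + 1) := by ring


/-! ### Peeling and the growth of arms -/

/-- Fewer than `δ + 1` elements have fewer than `δ` elements below them. -/
theorem card_filter_few_below_le {α : Type*} [DecidableEq α] (S : Finset α) (rk : α → ℕ)
    (hrk : Set.InjOn rk S) (δ : ℕ) :
    (S.filter fun g => (S.filter fun h => rk h < rk g).card < δ).card ≤ δ := by
  set T := S.filter fun g => (S.filter fun h => rk h < rk g).card < δ with hT
  by_contra! hlt
  obtain ⟨g, hg, hmax⟩ := T.exists_max_image rk (Finset.card_pos.1 (by omega))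
  have h1 : T.erase g ⊆ S.filter fun h => rk h < rk g := by
    intro h hh
    obtain ⟨hne, hh⟩ := Finset.mem_erase.1 hh
    have hS : h ∈ S := (Finset.mem_filter.1 hh).1
    refine Finset.mem_filter.2 ⟨hS, lt_of_le_of_ne (hmax h hh) fun h' => hne ?_⟩
    exact hrk hS (Finset.mem_filter.1 hg).1 h'
  have h2 := Finset.card_le_card h1
  rw [Finset.card_erase_of_mem hg] at h2
  have := (Finset.mem_filter.1 hg).2
  omega

namespace FaultConfig

variable {V : Type u} [Fintype V] {X : SimpleGraph V} {r f : ℕ} (c : FaultConfig X r f)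

open Classical in
/-- Drop the `δ` lightest edges at each vertex. -/
noncomputable def peel (δ : ℕ) (S : Finset (Sym2 V)) : Finset (Sym2 V) :=
  S.filter fun g => ∀ s ∈ g, δ ≤ (S.filter fun h => s ∈ h ∧ c.rank h < c.rank g).card

open Classical in
/-- Level `0` consists of the edges that are faults of at most `2 * f` edges; the next level arises
by dropping the `δ` lightest edges at each vertex. -/
noncomputable def level (δ : ℕ) : ℕ → Finset (Sym2 V)
  | 0 => X.edgeFinset.filter fun g => (X.edgeFinset.filter fun e => g ∈ c.F e).card ≤ 2 * f
  | j + 1 => c.peel δ (level δ j)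

theorem level_anti (δ : ℕ) : Antitone (c.level δ) := by
  classical
  refine antitone_nat_of_succ_le fun j => ?_
  rw [level, peel]
  exact Finset.filter_subset _ _

theorem mem_edgeSet_of_mem_level {δ j : ℕ} {g : Sym2 V} (hg : g ∈ c.level δ j) :
    g ∈ X.edgeSet := by
  classical
  have := c.level_anti δ (Nat.zero_le j) hg
  simp only [level, Finset.mem_filter, SimpleGraph.mem_edgeFinset] at this
  exact this.1

/-- Double counting of pairs of an edge and one of its faults: there are at most `f` per edge, so at
most half of the edges are faults of more than `2 * f` edges. -/
theorem card_le_level_zero (δ : ℕ) : X.edgeSet.ncard ≤ 2 * (c.level δ 0).card := by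
  classical
  have hE : X.edgeSet.ncard = X.edgeFinset.card := by
    rw [← Set.ncard_coe_finset, SimpleGraph.coe_edgeFinset]
  rw [hE]
  have h1 := Finset.card_filter_add_card_filter_not (s := X.edgeFinset)
    (fun g => (X.edgeFinset.filter fun e => g ∈ c.F e).card ≤ 2 * f)
  set T := X.edgeFinset.filter fun g => ¬ (X.edgeFinset.filter fun e => g ∈ c.F e).card ≤ 2 * f
    with hT
  have h2 : T.card * (2 * f + 1) ≤ X.edgeFinset.card * f := by
    refine Finset.card_mul_le_card_mul (fun g e => g ∈ c.F e) ?_ ?_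
    · intro g hg
      have := (Finset.mem_filter.1 hg).2
      simp only [Finset.bipartiteAbove]
      omega
    · intro e _
      refine le_trans (Finset.card_le_card ?_) (c.card_F e)
      intro g hg
      exact (Finset.mem_filter.1 hg).2
  have h3 : (c.level δ 0).card + T.card = X.edgeFinset.card := by
    simp only [level]
    convert h1
  have h4 : 2 * T.card ≤ X.edgeFinset.card := by
    by_contra! h
    nlinarith
  omega

theorem card_level_le_succ (δ j : ℕ) :
    (c.level δ j).card ≤ (c.level δ (j + 1)).card + Fintype.card V * δ := by
  classical
  have hsub : c.level δ j ⊆ c.level δ (j + 1) ∪ Finset.univ.biUnion fun s : V =>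
      ((c.level δ j).filter fun g => s ∈ g).filter fun g =>
        (((c.level δ j).filter fun g => s ∈ g).filter fun h => c.rank h < c.rank g).card < δ := by
    intro g hg
    by_cases h : g ∈ c.level δ (j + 1)
    · exact Finset.mem_union_left _ h
    · refine Finset.mem_union_right _ ?_
      simp only [level, peel, Finset.mem_filter, not_and, not_forall, not_le] at h
      obtain ⟨s, hs, hlt⟩ := h hg
      refine Finset.mem_biUnion.2 ⟨s, Finset.mem_univ _, Finset.mem_filter.2
        ⟨Finset.mem_filter.2 ⟨hg, hs⟩, ?_⟩⟩
      rw [Finset.filter_filter]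
      exact hlt
  refine (Finset.card_le_card hsub).trans ((Finset.card_union_le _ _).trans ?_)
  gcongr
  refine (Finset.card_biUnion_le_card_mul _ _ δ fun s _ => ?_).trans (by simp)
  refine card_filter_few_below_le _ _ ?_ _
  intro g hg h hh
  exact c.rank_inj (c.mem_edgeSet_of_mem_level (Finset.mem_filter.1 hg).1)
    (c.mem_edgeSet_of_mem_level (Finset.mem_filter.1 hh).1)

theorem card_edgeSet_le_level (δ j : ℕ) :
    X.edgeSet.ncard ≤ 2 * ((c.level δ j).card + j * (Fintype.card V * δ)) := by
  induction j with
  | zero => simpa using c.card_le_level_zero δ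
  | succ j ih =>
    have := c.card_level_le_succ δ j
    have h : (j + 1) * (Fintype.card V * δ) = j * (Fintype.card V * δ) + Fintype.card V * δ := by
      ring
    omega

/-- The edges that have `g` as a fault number at most `2 * f` because `g` is on level `0`; `g` has
at most `f` faults; each edge that has `g` as a fault contributes at most `f` further ones. -/
theorem card_rel_le {δ j : ℕ} {g : Sym2 V} (hg : g ∈ c.level δ j) (T : Finset (Sym2 V))
    (hT : ∀ h ∈ T, h ∈ X.edgeSet ∧ c.Rel g h) : T.card ≤ 3 * f + 2 * f * f := by
  classical
  have h0 := c.level_anti δ (Nat.zero_le j) hg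
  simp only [level, Finset.mem_filter] at h0
  set I := X.edgeFinset.filter fun e => g ∈ c.F e with hI
  have hsub : T ⊆ (I ∪ c.F g) ∪ I.biUnion c.F := by
    intro h hh
    obtain ⟨hE, H | H | ⟨e, he, H, H'⟩⟩ := hT h hh
    · exact Finset.mem_union_left _ (Finset.mem_union_left _
        (Finset.mem_filter.2 ⟨by simpa using hE, H⟩))
    · exact Finset.mem_union_left _ (Finset.mem_union_right _ H)
    · exact Finset.mem_union_right _ (Finset.mem_biUnion.2
        ⟨e, Finset.mem_filter.2 ⟨by simpa using he, H⟩, H'⟩)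
  have h1 : I.card ≤ 2 * f := by convert h0.2
  calc T.card ≤ _ := Finset.card_le_card hsub
    _ ≤ (I.card + (c.F g).card) + (I.biUnion c.F).card :=
      (Finset.card_union_le _ _).trans (by gcongr; exact Finset.card_union_le _ _)
    _ ≤ (2 * f + f) + 2 * f * f := by
      gcongr
      · exact c.card_F g
      · exact (Finset.card_biUnion_le_card_mul _ _ f fun e _ => c.card_F e).trans (by gcongr)
    _ = _ := by ring

/-- Clean walks of edges that are lighter than `e` and are no faults of `e`. -/
def IsArm (e : Sym2 V) {a b : V} (p : X.Walk a b) : Prop :=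
  c.Clean p.edges ∧ ∀ h ∈ p.edges, c.rank h < c.rank e ∧ h ∉ c.F e

open Classical in
/-- The far ends of the arms of `e` that start in `a`. -/
noncomputable def armEnds (e : Sym2 V) (a : V) : Finset V :=
  Finset.univ.filter fun b => ∃ p : X.Walk a b, p.length = r ∧ c.IsArm e p

/-- Arms grow one edge at a time, and each step uses up one level. The edge `g` at the current end
is as light as anything before it, so every edge lighter than `g` keeps the walk descending. -/
theorem exists_arm_ends {δ m : ℕ} (hm : m + f + (r - 1) * (3 * f + 2 * f * f) ≤ δ)
    {e : Sym2 V} (he : e ∈ c.level δ r) {a : V} (ha : a ∈ e) {i : ℕ} (hi : i ≤ r) :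
    ∃ S : Finset V, m ^ i ≤ S.card ∧ ∀ s ∈ S, ∃ p : X.Walk a s, p.length = i ∧ c.IsArm e p ∧
      (∀ h ∈ p.edges, h ∈ c.level δ 0) ∧
      ∃ g ∈ c.level δ (r - i), s ∈ g ∧ ∀ h ∈ e :: p.edges, c.rank g ≤ c.rank h := by
  classical
  induction i with
  | zero =>
    refine ⟨{a}, by simp, fun s hs => ?_⟩
    obtain rfl := Finset.mem_singleton.1 hs
    exact ⟨.nil, rfl, ⟨List.Pairwise.nil, by simp⟩, by simp, e, by simpa using he, ha, by simp⟩
  | succ i ih =>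
    obtain ⟨S, hS, hp⟩ := ih (by omega)
    have hp : ∀ s : S, _ := fun s => hp s s.2
    choose p hlen harm hlev g hg hsg hmin using hp
    set next : S → Finset V := fun s => Finset.univ.filter fun x =>
      s(s.1, x) ∈ c.level δ (r - (i + 1)) ∧ c.rank s(s.1, x) < c.rank (g s) ∧ s(s.1, x) ∉ c.F e ∧
        ∀ h ∈ (p s).edges, ¬ c.Rel h s(s.1, x) with hnext
    have hadj : ∀ s x, x ∈ next s → X.Adj s.1 x := fun s x hx =>
      c.mem_edgeSet_of_mem_level (Finset.mem_filter.1 hx).2.1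
    have hlow : ∀ s x, x ∈ next s → ∀ h ∈ e :: (p s).edges,
        c.rank s(s.1, x) < c.rank h := fun s x hx h hh =>
      (Finset.mem_filter.1 hx).2.2.1.trans_le (hmin s h hh)
    have harm' : ∀ s x (hx : x ∈ next s),
        c.IsArm e ((p s).concat (hadj s x hx)) := by
      intro s x hx
      have hx' := (Finset.mem_filter.1 hx).2
      refine ⟨?_, ?_⟩
      · rw [Clean, SimpleGraph.Walk.edges_concat, List.concat_eq_append, List.pairwise_append]
        refine ⟨(harm s).1, by simp, fun h hh h' hh' => ?_⟩
        obtain rfl := List.mem_singleton.1 hh'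
        exact ⟨hlow s x hx h (List.mem_cons_of_mem _ hh), hx'.2.2.2 h hh⟩
      · intro h hh
        rw [SimpleGraph.Walk.edges_concat, List.concat_eq_append, List.mem_append,
          List.mem_singleton] at hh
        rcases hh with hh | rfl
        · exact (harm s).2 h hh
        · exact ⟨hlow s x hx e (by simp), hx'.2.2.1⟩
    -- `g s` has survived a peeling, so at least `δ` lighter edges of the level below meet it at
    -- `s`. Discard the faults of `e` and the edges related to one of the at most `r - 1` edges of
    -- the walk; `m` remain.
    have hcard : ∀ s, m ≤ (next s).card := by
      intro s
      have hg' := hg s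
      have e1 : r - i = r - (i + 1) + 1 := by omega
      rw [e1, level, peel, Finset.mem_filter] at hg'
      have hδ := hg'.2 s.1 (hsg s)
      set A := (c.level δ (r - (i + 1))).filter fun h => s.1 ∈ h ∧ c.rank h < c.rank (g s) with hA
      have hsub : A ⊆ ((next s).image fun x => s(s.1, x)) ∪ (c.F e ∪
          (p s).edges.toFinset.biUnion fun h => A.filter fun h' => c.Rel h h') := by
        intro h hh
        obtain ⟨hh1, hh2, hh3⟩ := Finset.mem_filter.1 hh
        by_cases h1 : h ∈ c.F e
        · exact Finset.mem_union_right _ (Finset.mem_union_left _ h1)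
        by_cases h2 : ∃ h' ∈ (p s).edges, c.Rel h' h
        · obtain ⟨h', hh', hr⟩ := h2
          exact Finset.mem_union_right _ (Finset.mem_union_right _ (Finset.mem_biUnion.2
            ⟨h', by simpa using hh', Finset.mem_filter.2 ⟨hh, hr⟩⟩))
        · obtain ⟨x, rfl⟩ := hh2
          refine Finset.mem_union_left _ (Finset.mem_image.2 ⟨x, Finset.mem_filter.2
            ⟨Finset.mem_univ _, hh1, hh3, h1, fun h hp hr => h2 ⟨h, hp, hr⟩⟩, rfl⟩)
      have hB : ((p s).edges.toFinset.biUnion fun h => A.filter fun h' => c.Rel h h').card ≤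
          (r - 1) * (3 * f + 2 * f * f) := by
        refine (Finset.card_biUnion_le_card_mul _ _ (3 * f + 2 * f * f) fun h hh => ?_).trans ?_
        · refine c.card_rel_le (hlev s h (by simpa using hh)) _ fun h' hh' => ?_
          obtain ⟨h1, h2⟩ := Finset.mem_filter.1 hh'
          exact ⟨c.mem_edgeSet_of_mem_level (Finset.mem_filter.1 h1).1, h2⟩
        · gcongr
          refine (List.toFinset_card_le _).trans ?_
          rw [SimpleGraph.Walk.length_edges, hlen s]
          omega
      have h1 := Finset.card_le_card hsub
      have h2 := Finset.card_union_le ((next s).image fun x => s(s.1, x)) (c.F e ∪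
          (p s).edges.toFinset.biUnion fun h => A.filter fun h' => c.Rel h h')
      have h3 := Finset.card_union_le (c.F e)
          ((p s).edges.toFinset.biUnion fun h => A.filter fun h' => c.Rel h h')
      have h4 := Finset.card_image_le (s := next s) (f := fun x => s(s.1, x))
      have h5 := c.card_F e
      omega
    refine ⟨Finset.univ.biUnion next, ?_, ?_⟩
    · rw [Finset.card_biUnion]
      · calc m ^ (i + 1) = m ^ i * m := pow_succ _ _
          _ ≤ S.card * m := by gcongr
          _ ≤ _ := by
            simpa using Finset.card_nsmul_le_sum Finset.univ (fun s => (next s).card) m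
              fun s _ => hcard s
      · intro s _ s' _ hne
        rw [Function.onFun, Finset.disjoint_left]
        intro x hx hx'
        refine hne (Subtype.ext ?_)
        -- Extensions with the same far end coincide, and so do their penultimate vertices `s` and
        -- `s'`.
        have := c.clean_unique ((p s).concat (hadj s x hx)) ((p s').concat (hadj s' x hx'))
          (by simp [hlen s, hlen s']) (by simp [hlen s]; omega)
          (harm' s x hx).1 (harm' s' x hx').1
        have h2 := congrArg SimpleGraph.Walk.penultimate this
        simpa using h2
    · intro x hx
      obtain ⟨s, -, hx⟩ := Finset.mem_biUnion.1 hx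
      have hx' := (Finset.mem_filter.1 hx).2
      refine ⟨(p s).concat (hadj s x hx), by simp [hlen s], harm' s x hx, ?_, s(s.1, x),
        hx'.1, by simp, ?_⟩
      · intro h hh
        rw [SimpleGraph.Walk.edges_concat, List.concat_eq_append, List.mem_append,
          List.mem_singleton] at hh
        rcases hh with hh | rfl
        · exact hlev s h hh
        · exact c.level_anti δ (Nat.zero_le _) hx'.1
      · intro h hh
        rw [SimpleGraph.Walk.edges_concat, List.concat_eq_append, ← List.cons_append,
          List.mem_append, List.mem_singleton] at hh
        rcases hh with hh | rfl
        · exact (hlow s x hx h hh).le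
        · exact le_rfl

theorem pow_le_card_armEnds {δ m : ℕ} (hm : m + f + (r - 1) * (3 * f + 2 * f * f) ≤ δ)
    {e : Sym2 V} (he : e ∈ c.level δ r) {a : V} (ha : a ∈ e) : m ^ r ≤ (c.armEnds e a).card := by
  classical
  obtain ⟨S, hS, hp⟩ := c.exists_arm_ends hm he ha le_rfl
  refine hS.trans (Finset.card_le_card fun s hs => ?_)
  obtain ⟨p, h1, h2, -⟩ := hp s hs
  exact Finset.mem_filter.2 ⟨Finset.mem_univ _, p, h1, h2⟩

end FaultConfig

/-! ### Tame walks and common ends -/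

namespace FaultConfig

variable {V : Type u} {X : SimpleGraph V} {r f : ℕ} (c : FaultConfig X r f)

/-- Lists of distinct edges without an edge together with two of its faults. -/
def Tame (l : List (Sym2 V)) : Prop :=
  l.Nodup ∧ ∀ e ∈ l, ∀ g ∈ l, ∀ h ∈ l, g ≠ h → g ∈ c.F e → h ∉ c.F e

theorem Tame.sublist {l l' : List (Sym2 V)} (h : c.Tame l) (hl : l'.Sublist l) : c.Tame l' :=
  ⟨h.1.sublist hl, fun e he g hg g' hg' => h.2 e (hl.subset he) g (hl.subset hg) g'
    (hl.subset hg')⟩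

/-- There are at most `f + 1` edge-disjoint tame walks of length at most `r + 1` between two
vertices. -/
theorem card_le_of_edge_disjoint {ι : Type*} [DecidableEq ι] (J : Finset ι) {a b : V}
    (p : ι → X.Walk a b) (hne : ∀ i ∈ J, (p i).edges ≠ []) {l : ℕ} (hl : l ≤ r + 1)
    (hlen : ∀ i ∈ J, (p i).length = l)
    (htame : ∀ i ∈ J, c.Tame (p i).edges)
    (hdisj : ∀ i ∈ J, ∀ j ∈ J, i ≠ j → ∀ g ∈ (p i).edges, g ∉ (p j).edges) :
    J.card ≤ f + 1 := by
  classical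
  by_contra! hJ
  set U := J.biUnion fun i => (p i).edges.toFinset with hU
  have hmemU : ∀ i ∈ J, ∀ g ∈ (p i).edges, g ∈ U := fun i hi g hg =>
    Finset.mem_biUnion.2 ⟨i, hi, by simpa using hg⟩
  have hUne : U.Nonempty := by
    obtain ⟨i, hi⟩ := Finset.card_pos.1 (show 0 < J.card by omega)
    obtain ⟨g, hg⟩ := List.exists_mem_of_ne_nil _ (hne i hi)
    exact ⟨g, hmemU i hi g hg⟩
  obtain ⟨e, heU, hmax⟩ := U.exists_max_image c.rank hUne
  obtain ⟨i, hi, hei⟩ := Finset.mem_biUnion.1 heU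
  have hei : e ∈ (p i).edges := by simpa using hei
  have hUE : ∀ g ∈ U, g ∈ X.edgeSet := by
    intro g hg
    obtain ⟨j, hj, hgj⟩ := Finset.mem_biUnion.1 hg
    exact SimpleGraph.Walk.edges_subset_edgeSet (p j) (by simpa using hgj)
  have hlt : ∀ g ∈ U, g ≠ e → c.rank g < c.rank e := fun g hg hge =>
    lt_of_le_of_ne (hmax g hg) fun h => hge (c.rank_inj (hUE g hg) (hUE e heU) h)
  -- Pigeonhole: at least `f + 1` disjoint walks remain besides `p i`, and the heaviest edge `e` has
  -- at most `f` faults.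
  obtain ⟨j, hj, hji, hunhit⟩ : ∃ j ∈ J, j ≠ i ∧ ∀ g ∈ (p j).edges, g ∉ c.F e := by
    by_contra! hcon
    have : Nonempty (Sym2 V) := ⟨e⟩
    choose! g hg hgF using hcon
    have hinj : Set.InjOn g (↑(J.erase i) : Set ι) := by
      intro j hj j' hj' hgg
      by_contra hjj
      have hj := Finset.mem_erase.1 (Finset.mem_coe.1 hj)
      have hj' := Finset.mem_erase.1 (Finset.mem_coe.1 hj')
      refine hdisj j hj.2 j' hj'.2 hjj (g j) (hg j hj.2 hj.1) ?_
      rw [hgg]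
      exact hg j' hj'.2 hj'.1
    have h1 : (J.erase i).card ≤ (c.F e).card :=
      Finset.card_le_card_of_injOn g (fun j hj => by
        have hj := Finset.mem_erase.1 (Finset.mem_coe.1 hj)
        exact hgF j hj.2 hj.1) hinj
    rw [Finset.card_erase_of_mem hi] at h1
    have := c.card_F e
    omega
  obtain ⟨x, y, q, h, q', rfl, hpi⟩ := exists_split_of_mem_edges (p i) hei
  have hnd := (htame i hi).1
  have hle := hlen i hi
  rw [hpi] at hnd hle
  simp only [SimpleGraph.Walk.edges_append, SimpleGraph.Walk.edges_cons] at hnd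
  simp only [SimpleGraph.Walk.length_append, SimpleGraph.Walk.length_cons] at hle
  have hq : ∀ g ∈ q.edges, g ∈ (p i).edges ∧ g ≠ s(x, y) := fun g hg => by
    refine ⟨by rw [hpi]; simp [hg], fun hge => ?_⟩
    subst hge
    exact (List.disjoint_of_nodup_append hnd) hg (by simp)
  have hq' : ∀ g ∈ q'.edges, g ∈ (p i).edges ∧ g ≠ s(x, y) := fun g hg => by
    refine ⟨by rw [hpi]; simp [hg], fun hge => ?_⟩
    subst hge
    exact (List.nodup_cons.1 (List.nodup_append.1 hnd).2.1).1 hg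
  have hpj : ∀ g ∈ (p j).edges, g ≠ s(x, y) := fun g hg hge =>
    hdisj i hi j hj hji.symm _ hei (hge ▸ hg)
  -- The rest of `p i` and all of `p j` bypass `e` with `2 * l - 1 ≤ 2 * r + 1` edges. As `p j` is
  -- free of faults of `e`, two of them lie on `p i`, against tameness.
  obtain ⟨g, hg, g', hg', hgg, hgF, hgF'⟩ := c.hit_twice x y h
    (q.reverse.append ((p j).append q'.reverse))
    (by
      intro g hg
      simp only [SimpleGraph.Walk.edges_append, SimpleGraph.Walk.edges_reverse, List.mem_append,
        List.mem_reverse] at hg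
      rcases hg with hg | hg | hg
      · exact hlt g (hmemU i hi g (hq g hg).1) (hq g hg).2
      · exact hlt g (hmemU j hj g hg) (hpj g hg)
      · exact hlt g (hmemU i hi g (hq' g hg).1) (hq' g hg).2)
    (by simp [hlen j hj]; omega)
  have key : ∀ g, g ∈ (q.reverse.append ((p j).append q'.reverse)).edges → g ∈ c.F s(x, y) →
      g ∈ (p i).edges := by
    intro g hg hgF
    simp only [SimpleGraph.Walk.edges_append, SimpleGraph.Walk.edges_reverse, List.mem_append,
      List.mem_reverse] at hg
    rcases hg with hg | hg | hg
    · exact (hq g hg).1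
    · exact absurd hgF (hunhit g hg)
    · exact (hq' g hg).1
  exact (htame i hi).2 _ hei g (key g hg hgF) g' (key g' hg' hgF') hgg hgF hgF'

variable [Fintype V]

open Classical in
/-- The second vertices of the tame walks of length `l + 1` from `a` to `b`. -/
noncomputable def steps (a b : V) (l : ℕ) : Finset V :=
  Finset.univ.filter fun x => ∃ (h : X.Adj a x) (p : X.Walk x b), p.length = l ∧
    c.Tame (p.cons h).edges

/-- Take a maximal edge-disjoint family of the walks; it has at most `f + 1` members. Every other
walk shares an edge with the family, so an initial piece of it is a shorter tame walk to one of the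
few vertices of the family, or is just its first edge. Induction counts these. -/
theorem card_steps_le {l : ℕ} (hl : l ≤ r) (a b : V) :
    (c.steps a b l).card ≤ ((f + 1) * ((r + 2) * (r + 1))) ^ l := by
  classical
  induction l using Nat.strong_induction_on generalizing b with
  | _ l ih =>
  rcases l with _ | l
  · refine le_of_le_of_eq (Finset.card_le_one.2 ?_) (pow_zero _).symm
    intro x hx y hy
    simp only [steps, Finset.mem_filter, Finset.mem_univ, true_and] at hx hy
    obtain ⟨-, p, hp, -⟩ := hx
    obtain ⟨-, q, hq, -⟩ := hy
    rw [SimpleGraph.Walk.eq_of_length_eq_zero hp, SimpleGraph.Walk.eq_of_length_eq_zero hq]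
  set I := c.steps a b (l + 1) with hI
  have hI' : ∀ x : I, ∃ p : X.Walk a b, p.length = l + 2 ∧ c.Tame p.edges ∧
      ∃ (h : X.Adj a x) (q : X.Walk x b), p = q.cons h := by
    intro x
    have hx : x.1 ∈ c.steps a b (l + 1) := x.2
    simp only [steps, Finset.mem_filter, Finset.mem_univ, true_and] at hx
    obtain ⟨h, q, hq, ht⟩ := hx
    exact ⟨q.cons h, by simp [hq], ht, h, q, rfl⟩
  choose p hlen htame hcons using hI'
  let P : Finset I → Prop := fun J => ∀ i ∈ J, ∀ j ∈ J, i ≠ j →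
    ∀ g ∈ (p i).edges, g ∉ (p j).edges
  obtain ⟨J, hJ, hmax⟩ := Finset.exists_max_image (Finset.univ.filter P) Finset.card
    ⟨∅, by simp [P]⟩
  have hdisj : P J := (Finset.mem_filter.1 hJ).2
  have hJcard : J.card ≤ f + 1 := by
    refine c.card_le_of_edge_disjoint J p (fun i _ h => ?_) (l := l + 2) (by omega)
      (fun i _ => hlen i) (fun i _ => htame i) hdisj
    have := hlen i
    rw [← SimpleGraph.Walk.length_edges, h] at this
    simp at this
  have hshare : ∀ x : I, ∃ j ∈ J, ∃ g ∈ (p x).edges, g ∈ (p j).edges := by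
    intro x
    by_cases hx : x ∈ J
    · obtain ⟨h, q, hq⟩ := hcons x
      exact ⟨x, hx, s(a, x), by simp [hq], by simp [hq]⟩
    by_contra! hcon
    have hins := hmax (insert x J) (Finset.mem_filter.2 ⟨Finset.mem_univ _, ?_⟩)
    · rw [Finset.card_insert_of_notMem hx] at hins
      omega
    · intro i hi j hj hij g hg hgj
      rcases Finset.mem_insert.1 hi with rfl | hi' <;> rcases Finset.mem_insert.1 hj with rfl | hj'
      · exact hij rfl
      · exact hcon j hj' g hg hgj
      · exact hcon i hi' g hgj hg
      · exact hdisj i hi' j hj' hij g hg hgj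
  have hsub : I ⊆ J.biUnion fun j => (p j).support.toFinset.biUnion fun y =>
      (Finset.range (l + 1)).biUnion fun i => c.steps a y i := by
    intro x hx
    obtain ⟨j, hj, g, hg, hgj⟩ := hshare ⟨x, hx⟩
    have htx := htame ⟨x, hx⟩
    have hlx := hlen ⟨x, hx⟩
    obtain ⟨h, q, hq⟩ := hcons ⟨x, hx⟩
    rw [hq] at hg htx hlx
    suffices ∃ y ∈ (p j).support, ∃ i < l + 1, x ∈ c.steps a y i by
      obtain ⟨y, hy, i, hi, hxy⟩ := this
      exact Finset.mem_biUnion.2 ⟨j, hj, Finset.mem_biUnion.2 ⟨y, by simpa using hy,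
        Finset.mem_biUnion.2 ⟨i, by simpa using hi, hxy⟩⟩⟩
    simp only [SimpleGraph.Walk.edges_cons, List.mem_cons] at hg
    rcases hg with rfl | hg
    · refine ⟨x, (p j).snd_mem_support_of_mem_edges hgj, 0, by omega, ?_⟩
      simp only [steps, Finset.mem_filter, Finset.mem_univ, true_and]
      refine ⟨h, .nil, rfl, Tame.sublist c htx ?_⟩
      simp
    · obtain ⟨y, z, q₁, h', q₂, rfl, rfl⟩ := exists_split_of_mem_edges q hg
      refine ⟨y, (p j).fst_mem_support_of_mem_edges hgj, q₁.length, ?_, ?_⟩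
      · simp at hlx
        omega
      · simp only [steps, Finset.mem_filter, Finset.mem_univ, true_and]
        refine ⟨h, q₁, rfl, Tame.sublist c htx ?_⟩
        simp
  set D := (f + 1) * ((r + 2) * (r + 1)) with hD
  have hDpos : 0 < D := by positivity
  calc I.card ≤ _ := Finset.card_le_card hsub
    _ ≤ J.card * ((l + 3) * ((l + 1) * D ^ l)) := by
      refine Finset.card_biUnion_le_card_mul _ _ _ fun j _ => ?_
      refine (Finset.card_biUnion_le_card_mul _ _ ((l + 1) * D ^ l) fun y _ => ?_).trans ?_
      · refine (Finset.card_biUnion_le_card_mul _ _ (D ^ l) fun i hi => ?_).trans (by simp)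
        have hi : i < l + 1 := by simpa using hi
        exact (ih i hi (by omega) y).trans (Nat.pow_le_pow_right hDpos (by omega))
      · gcongr
        refine (List.toFinset_card_le _).trans ?_
        rw [SimpleGraph.Walk.length_support, hlen]
    _ ≤ (f + 1) * ((r + 2) * ((r + 1) * D ^ l)) :=
      Nat.mul_le_mul hJcard (Nat.mul_le_mul (by omega) (Nat.mul_le_mul_right _ (by omega)))
    _ = D ^ (l + 1) := by rw [pow_succ, hD]; ring

open Classical in
/-- The far ends shared by walks from `a` and clean walks from `b`, all of length `r`. -/
noncomputable def commonEnds (a b : V) : Finset V :=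
  Finset.univ.filter fun s => (∃ p : X.Walk a s, p.length = r) ∧
    ∃ p : X.Walk b s, p.length = r ∧ c.Clean p.edges

/-- If `a` is on the clean walk, the end is less than `r` steps from `a`. Otherwise the walk from
`a` enters the clean walk by some edge, and this edge followed by the clean walk back to `b` is
tame. So `card_steps_le` bounds the choices at that step, where the degree would give `Δ`. -/
theorem card_commonEnds_le {Δ : ℕ} (hΔ : ∀ v, (X.neighborSet v).ncard ≤ Δ) (hΔ0 : 0 < Δ) {a b : V}
    (hab : a ≠ b) : (c.commonEnds a b).card ≤
      (r + 1) ^ 2 * ((f + 1) * ((r + 2) * (r + 1))) ^ r * Δ ^ (r - 1) := by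
  classical
  set D := (f + 1) * ((r + 2) * (r + 1)) with hD
  have hDpos : 0 < D := by positivity
  have hsub : c.commonEnds a b ⊆ ((Finset.range r).biUnion fun i => reach X i a) ∪
      (Finset.range r).biUnion fun i => (reach X i a).biUnion fun x =>
        (Finset.range (r + 1)).biUnion fun l => (c.steps x b l).biUnion fun y =>
          reach X (r - 1 - i) y := by
    intro s hs
    simp only [commonEnds, Finset.mem_filter, Finset.mem_univ, true_and] at hs
    obtain ⟨⟨p, hp⟩, q, hq, hclean⟩ := hs
    by_cases ha : a ∈ q.support
    · refine Finset.mem_union_left _ (Finset.mem_biUnion.2 ⟨(q.dropUntil a ha).length, ?_,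
        mem_reach _⟩)
      have h1 := congrArg SimpleGraph.Walk.length (q.take_spec ha)
      rw [SimpleGraph.Walk.length_append] at h1
      have h2 : (q.takeUntil a ha).length ≠ 0 := fun h =>
        hab (SimpleGraph.Walk.eq_of_length_eq_zero h).symm
      rw [Finset.mem_range]
      omega
    · obtain ⟨x, y, p₁, h, p₂, hx, hy, rfl⟩ :=
        exists_split_of_enter p {v | v ∈ q.support} ha q.end_mem_support
      simp only [SimpleGraph.Walk.length_append, SimpleGraph.Walk.length_cons] at hp
      have hlen2 : p₂.length = r - 1 - p₁.length := by omega
      refine Finset.mem_union_right _ (Finset.mem_biUnion.2 ⟨p₁.length, ?_,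
        Finset.mem_biUnion.2 ⟨x, mem_reach p₁, Finset.mem_biUnion.2
          ⟨(q.takeUntil y hy).length, ?_, Finset.mem_biUnion.2 ⟨y, ?_, hlen2 ▸ mem_reach p₂⟩⟩⟩⟩)
      · rw [Finset.mem_range]
        omega
      · have h1 := congrArg SimpleGraph.Walk.length (q.take_spec hy)
        rw [SimpleGraph.Walk.length_append] at h1
        rw [Finset.mem_range]
        omega
      · simp only [steps, Finset.mem_filter, Finset.mem_univ, true_and]
        have hE : ∀ g ∈ (q.takeUntil y hy).reverse.edges, g ∈ q.edges := fun g hg => by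
          have : g ∈ (q.takeUntil y hy).edges := by simpa using hg
          rw [← q.take_spec hy, SimpleGraph.Walk.edges_append]
          exact List.mem_append_left _ this
        have hnd : (q.takeUntil y hy).reverse.edges.Nodup := by
          have := Clean.nodup c hclean
          rw [← q.take_spec hy, SimpleGraph.Walk.edges_append] at this
          simpa using (List.nodup_append.1 this).1
        refine ⟨h, (q.takeUntil y hy).reverse, by simp, ?_, ?_⟩
        · rw [SimpleGraph.Walk.edges_cons, List.nodup_cons]
          exact ⟨fun hm => hx (q.fst_mem_support_of_mem_edges (hE _ hm)), hnd⟩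
        -- At most one of `e`, `g`, `g'` is the entering edge `s(x, y)`. The other two are related,
        -- but lie on the clean walk.
        · intro e he g hg g' hg' hgg hgF hgF'
          have hxyE : s(x, y) ∈ X.edgeSet := h
          have hqE : ∀ g ∈ q.edges, g ∈ X.edgeSet := fun g hg =>
            SimpleGraph.Walk.edges_subset_edgeSet q hg
          have heg : e ≠ g := fun h => c.notMem_F e (by rw [← h] at hgF; exact hgF)
          have heg' : e ≠ g' := fun h => c.notMem_F e (by rw [← h] at hgF'; exact hgF')
          rw [SimpleGraph.Walk.edges_cons, List.mem_cons] at he hg hg'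
          have heE : e ∈ X.edgeSet := by
            rcases he with rfl | he
            exacts [hxyE, hqE e (hE e he)]
          rcases hg with h1 | h1
          · rcases he with h2 | h2
            · exact heg (h2.trans h1.symm)
            rcases hg' with h3 | h3
            · exact hgg (h1.trans h3.symm)
            exact Clean.not_rel c hclean (hE _ h2) (hE _ h3) heg' (Or.inr (Or.inl hgF'))
          · rcases hg' with h3 | h3
            · rcases he with h2 | h2
              · exact heg' (h2.trans h3.symm)
              exact Clean.not_rel c hclean (hE _ h2) (hE _ h1) heg (Or.inr (Or.inl hgF))
            · exact Clean.not_rel c hclean (hE _ h1) (hE _ h3) hgg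
                (Or.inr (Or.inr ⟨e, heE, hgF, hgF'⟩))
  refine (Finset.card_le_card hsub).trans ((Finset.card_union_le _ _).trans ?_)
  have h1 : ((Finset.range r).biUnion fun i => reach X i a).card ≤ r * Δ ^ (r - 1) := by
    refine (Finset.card_biUnion_le_card_mul _ _ (Δ ^ (r - 1)) fun i hi => ?_).trans (by simp)
    have hi : i < r := by simpa using hi
    exact (card_reach_le hΔ i a).trans (Nat.pow_le_pow_right hΔ0 (by omega))
  have h2 : ((Finset.range r).biUnion fun i => (reach X i a).biUnion fun x =>
        (Finset.range (r + 1)).biUnion fun l => (c.steps x b l).biUnion fun y =>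
          reach X (r - 1 - i) y).card ≤ r * ((r + 1) * D ^ r * Δ ^ (r - 1)) := by
    refine (Finset.card_biUnion_le_card_mul _ _ ((r + 1) * D ^ r * Δ ^ (r - 1))
      fun i hi => ?_).trans (by simp)
    have hi : i < r := by simpa using hi
    have e1 : Δ ^ (r - 1) = Δ ^ i * Δ ^ (r - 1 - i) := by rw [← pow_add]; congr 1; omega
    refine (Finset.card_biUnion_le_card_mul _ _ ((r + 1) * (D ^ r * Δ ^ (r - 1 - i)))
      fun x _ => ?_).trans ?_
    · refine (Finset.card_biUnion_le_card_mul _ _ (D ^ r * Δ ^ (r - 1 - i))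
        fun l hl => ?_).trans (by simp)
      have hl : l < r + 1 := by simpa using hl
      refine (Finset.card_biUnion_le_card_mul _ _ (Δ ^ (r - 1 - i))
        fun y _ => card_reach_le hΔ _ y).trans ?_
      gcongr
      exact (c.card_steps_le (by omega) x b).trans (Nat.pow_le_pow_right hDpos (by omega))
    · rw [e1]
      calc _ ≤ Δ ^ i * ((r + 1) * (D ^ r * Δ ^ (r - 1 - i))) := by
            gcongr
            exact card_reach_le hΔ i a
        _ = _ := by ring
  have h3 : 1 ≤ D ^ r := Nat.one_le_pow _ _ hDpos
  calc _ ≤ r * Δ ^ (r - 1) + r * ((r + 1) * D ^ r * Δ ^ (r - 1)) := by gcongr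
    _ ≤ (r + 1) * D ^ r * Δ ^ (r - 1) + r * ((r + 1) * D ^ r * Δ ^ (r - 1)) := by
      gcongr
      nlinarith
    _ = _ := by ring

end FaultConfig

/-! ### Counting pairs of arm ends -/

namespace FaultConfig

variable {V : Type u} [Fintype V] {X : SimpleGraph V} {r f : ℕ} (c : FaultConfig X r f)

open Classical in
/-- The vertices within distance less than `r` of a fault of `e`. -/
noncomputable def faultBall (e : Sym2 V) : Finset V :=
  (c.F e).biUnion fun g => (Finset.univ.filter (· ∈ g)).biUnion fun z =>
    (Finset.range r).biUnion fun i => reach X i z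

theorem card_faultBall_le {Δ : ℕ} (hΔ : ∀ v, (X.neighborSet v).ncard ≤ Δ) (hΔ0 : 0 < Δ)
    (e : Sym2 V) : (c.faultBall e).card ≤ f * (2 * (r * Δ ^ (r - 1))) := by
  classical
  refine (Finset.card_biUnion_le_card_mul _ _ (2 * (r * Δ ^ (r - 1))) fun g _ => ?_).trans
    (Nat.mul_le_mul_right _ (c.card_F e))
  refine (Finset.card_biUnion_le_card_mul _ _ (r * Δ ^ (r - 1)) fun z _ => ?_).trans
    (Nat.mul_le_mul_right _ ?_)
  · refine (Finset.card_biUnion_le_card_mul _ _ (Δ ^ (r - 1)) fun i hi => ?_).trans (by simp)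
    have hi : i < r := by simpa using hi
    exact (card_reach_le hΔ i z).trans (Nat.pow_le_pow_right hΔ0 (by omega))
  · induction g with
    | _ x y =>
      refine (Finset.card_le_card (t := {x, y}) fun z hz => ?_).trans Finset.card_le_two
      simpa using hz

/-- After a fault is crossed, at most `r - 1` steps are left; this saves a factor `Δ` against all
walks of length `r`. -/
theorem mem_faultBall {e g : Sym2 V} {a s : V} (p : X.Walk a s) (hp : p.length = r)
    (hg : g ∈ p.edges) (hgF : g ∈ c.F e) : s ∈ c.faultBall e := by
  classical
  obtain ⟨x, y, q, h, q', rfl, rfl⟩ := exists_split_of_mem_edges p hg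
  simp only [SimpleGraph.Walk.length_append, SimpleGraph.Walk.length_cons] at hp
  refine Finset.mem_biUnion.2 ⟨_, hgF, Finset.mem_biUnion.2 ⟨y, by simp, Finset.mem_biUnion.2
    ⟨q'.length, ?_, mem_reach q'⟩⟩⟩
  rw [Finset.mem_range]
  omega

/-- The pairs of far ends of arms of `e` that start at its two ends. -/
noncomputable def pairs (e : Sym2 V) : Finset (V × V) :=
  c.armEnds e (Quot.out e).1 ×ˢ c.armEnds e (Quot.out e).2

-- The arms of `e` and `e'`, together with `e'`, form a lighter detour around `e` of `4 * r + 1`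
-- edges. Its fault of `e` is not on the arms of `e`. If it is on an arm of `e'`, one end of the
-- pair lies in the fault ball. Otherwise it is `e'`, which leaves `f` choices; the two edges then
-- differ at both ends, and the pair consists of common ends.
open Classical in
theorem card_repeated_pairs_le {Δ : ℕ} (hΔ : ∀ v, (X.neighborSet v).ncard ≤ Δ) (hΔ0 : 0 < Δ)
    {e : Sym2 V} (he : e ∈ X.edgeSet) :
    ((c.pairs e).filter fun st => ∃ e' ∈ X.edgeSet, c.rank e' < c.rank e ∧
      st ∈ c.pairs e').card ≤ 2 * (f * (2 * (r * Δ ^ (r - 1))) * Δ ^ r) +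
        f * ((r + 1) ^ 2 * ((f + 1) * ((r + 2) * (r + 1))) ^ r * Δ ^ (r - 1)) ^ 2 := by
  set B := (r + 1) ^ 2 * ((f + 1) * ((r + 2) * (r + 1))) ^ r * Δ ^ (r - 1) with hB
  obtain ⟨u, hu⟩ : ∃ u, u = (Quot.out e).1 := ⟨_, rfl⟩
  obtain ⟨v, hv⟩ : ∃ v, v = (Quot.out e).2 := ⟨_, rfl⟩
  have huv : s(u, v) = e := by rw [hu, hv]; exact Quot.out_eq e
  have hS : ∀ a, (c.armEnds e a).card ≤ Δ ^ r := fun a => by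
    refine (Finset.card_le_card fun s hs => ?_).trans (card_reach_le hΔ r a)
    obtain ⟨p, hp, -⟩ := (Finset.mem_filter.1 hs).2
    exact hp ▸ mem_reach p
  have hsub : ((c.pairs e).filter fun st => ∃ e' ∈ X.edgeSet, c.rank e' < c.rank e ∧
      st ∈ c.pairs e') ⊆ (c.faultBall e ×ˢ c.armEnds e v ∪ c.armEnds e u ×ˢ c.faultBall e) ∪
        ((c.F e).filter fun e' => u ≠ (Quot.out e').1 ∧ v ≠ (Quot.out e').2).biUnion fun e' =>
          c.commonEnds u (Quot.out e').1 ×ˢ c.commonEnds v (Quot.out e').2 := by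
    rintro ⟨s, t⟩ hst
    obtain ⟨hst, e', he', hlt, hst'⟩ := Finset.mem_filter.1 hst
    rw [pairs, ← hu, ← hv, Finset.mem_product] at hst
    rw [pairs, Finset.mem_product] at hst'
    obtain ⟨b, hb⟩ : ∃ b, b = (Quot.out e').1 := ⟨_, rfl⟩
    obtain ⟨d, hd⟩ : ∃ d, d = (Quot.out e').2 := ⟨_, rfl⟩
    have hbd : s(b, d) = e' := by rw [hb, hd]; exact Quot.out_eq e'
    rw [← hb, ← hd] at hst'
    obtain ⟨p, hp, hpa⟩ := (Finset.mem_filter.1 hst.1).2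
    obtain ⟨q, hq, hqa⟩ := (Finset.mem_filter.1 hst.2).2
    obtain ⟨p', hp', hpa'⟩ := (Finset.mem_filter.1 hst'.1).2
    obtain ⟨q', hq', hqa'⟩ := (Finset.mem_filter.1 hst'.2).2
    simp only at hp hpa hq hqa hp' hpa' hq' hqa'
    by_cases h1 : ∃ g ∈ p'.edges, g ∈ c.F e
    · obtain ⟨g, hg, hgF⟩ := h1
      exact Finset.mem_union_left _ (Finset.mem_union_left _ (Finset.mem_product.2
        ⟨c.mem_faultBall p' hp' hg hgF, hst.2⟩))
    by_cases h2 : ∃ g ∈ q'.edges, g ∈ c.F e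
    · obtain ⟨g, hg, hgF⟩ := h2
      exact Finset.mem_union_left _ (Finset.mem_union_right _ (Finset.mem_product.2
        ⟨hst.1, c.mem_faultBall q' hq' hg hgF⟩))
    push Not at h1 h2
    have huvA : X.Adj u v := by rw [← SimpleGraph.mem_edgeSet, huv]; exact he
    have hbdA : X.Adj b d := by rw [← SimpleGraph.mem_edgeSet, hbd]; exact he'
    have hpl : ∀ g ∈ p.edges, c.rank g < c.rank s(u, v) := by
      rw [huv]; exact fun g hg => (hpa.2 g hg).1
    have hql : ∀ g ∈ q.edges, c.rank g < c.rank s(u, v) := by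
      rw [huv]; exact fun g hg => (hqa.2 g hg).1
    have hpl' : ∀ g ∈ p'.edges, c.rank g < c.rank s(u, v) := by
      rw [huv]; exact fun g hg => ((hpa'.2 g hg).1).trans hlt
    have hql' : ∀ g ∈ q'.edges, c.rank g < c.rank s(u, v) := by
      rw [huv]; exact fun g hg => ((hqa'.2 g hg).1).trans hlt
    have hle : c.rank s(b, d) < c.rank s(u, v) := by rw [huv, hbd]; exact hlt
    have h3 : e' ∈ c.F e := by
      obtain ⟨g, hg, hgF⟩ := c.hit u v huvA
        (p.append (p'.reverse.append ((q'.append q.reverse).cons hbdA)))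
        (by
          intro g hg
          simp only [SimpleGraph.Walk.edges_append, SimpleGraph.Walk.edges_cons, List.mem_append,
            List.mem_cons, SimpleGraph.Walk.edges_reverse, List.mem_reverse] at hg
          rcases hg with hg | hg | rfl | hg | hg
          exacts [hpl g hg, hpl' g hg, hle, hql' g hg, hql g hg])
        (by simp; omega)
      rw [huv] at hgF
      simp only [SimpleGraph.Walk.edges_append, SimpleGraph.Walk.edges_cons, List.mem_append,
        List.mem_cons, SimpleGraph.Walk.edges_reverse, List.mem_reverse] at hg
      rcases hg with hg | hg | rfl | hg | hg
      · exact absurd hgF (hpa.2 g hg).2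
      · exact absurd hgF (h1 g hg)
      · rwa [← hbd]
      · exact absurd hgF (h2 g hg)
      · exact absurd hgF (hqa.2 g hg).2
    -- A shared end would give a detour of `2 * r + 1` edges with `e'` as its only fault of `e`.
    have h4 : u ≠ b := by
      intro hub
      subst hub
      obtain ⟨g, hg, g', hg', hgg, hgF, hgF'⟩ := c.hit_twice u v huvA
        ((q'.append q.reverse).cons hbdA)
        (by
          intro g hg
          simp only [SimpleGraph.Walk.edges_append, SimpleGraph.Walk.edges_cons, List.mem_append,
            List.mem_cons, SimpleGraph.Walk.edges_reverse, List.mem_reverse] at hg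
          rcases hg with rfl | hg | hg
          exacts [hle, hql' g hg, hql g hg])
        (by simp; omega)
      rw [huv] at hgF hgF'
      have key : ∀ g ∈ ((q'.append q.reverse).cons hbdA).edges, g ∈ c.F e → g = s(u, d) := by
        intro g hg hgF
        simp only [SimpleGraph.Walk.edges_append, SimpleGraph.Walk.edges_cons, List.mem_append,
          List.mem_cons, SimpleGraph.Walk.edges_reverse, List.mem_reverse] at hg
        rcases hg with hg | hg | hg
        · exact hg
        · exact absurd hgF (h2 g hg)
        · exact absurd hgF (hqa.2 g hg).2
      exact hgg ((key g hg hgF).trans (key g' hg' hgF').symm)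
    have h5 : v ≠ d := by
      intro hvd
      subst hvd
      obtain ⟨g, hg, g', hg', hgg, hgF, hgF'⟩ := c.hit_twice u v huvA
        ((p.append p'.reverse).concat hbdA)
        (by
          intro g hg
          simp only [SimpleGraph.Walk.edges_append, SimpleGraph.Walk.edges_concat,
            List.concat_eq_append, List.mem_append, List.mem_singleton,
            SimpleGraph.Walk.edges_reverse, List.mem_reverse] at hg
          rcases hg with (hg | hg) | rfl
          exacts [hpl g hg, hpl' g hg, hle])
        (by simp; omega)
      rw [huv] at hgF hgF'
      have key : ∀ g ∈ ((p.append p'.reverse).concat hbdA).edges, g ∈ c.F e → g = s(b, v) := by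
        intro g hg hgF
        simp only [SimpleGraph.Walk.edges_append, SimpleGraph.Walk.edges_concat,
            List.concat_eq_append, List.mem_append, List.mem_singleton,
            SimpleGraph.Walk.edges_reverse, List.mem_reverse] at hg
        rcases hg with (hg | hg) | hg
        · exact absurd hgF (hpa.2 g hg).2
        · exact absurd hgF (h1 g hg)
        · exact hg
      exact hgg ((key g hg hgF).trans (key g' hg' hgF').symm)
    refine Finset.mem_union_right _ (Finset.mem_biUnion.2 ⟨e', Finset.mem_filter.2 ⟨h3, ?_, ?_⟩, ?_⟩)
    · rwa [← hb]
    · rwa [← hd]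
    · rw [← hb, ← hd]
      exact Finset.mem_product.2 ⟨Finset.mem_filter.2 ⟨Finset.mem_univ _, ⟨p, hp⟩, p', hp', hpa'.1⟩,
        Finset.mem_filter.2 ⟨Finset.mem_univ _, ⟨q, hq⟩, q', hq', hqa'.1⟩⟩
  refine (Finset.card_le_card hsub).trans ((Finset.card_union_le _ _).trans (Nat.add_le_add ?_ ?_))
  · refine (Finset.card_union_le _ _).trans ?_
    rw [Finset.card_product, Finset.card_product, two_mul]
    refine Nat.add_le_add (Nat.mul_le_mul (c.card_faultBall_le hΔ hΔ0 e) (hS v)) ?_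
    rw [mul_comm]
    exact Nat.mul_le_mul (c.card_faultBall_le hΔ hΔ0 e) (hS u)
  · refine (Finset.card_biUnion_le_card_mul _ _ (B ^ 2) fun e' he' => ?_).trans
      (Nat.mul_le_mul_right _ ((Finset.card_filter_le _ _).trans (c.card_F e)))
    obtain ⟨-, h1, h2⟩ := Finset.mem_filter.1 he'
    rw [Finset.card_product, sq]
    exact Nat.mul_le_mul (c.card_commonEnds_le hΔ hΔ0 h1) (c.card_commonEnds_le hΔ hΔ0 h2)

/-- Counting pairs of arm ends bounds the number of edges on the last level. -/
theorem card_level_mul_le {Δ δ m : ℕ} (hΔ : ∀ v, (X.neighborSet v).ncard ≤ Δ) (hΔ0 : 0 < Δ)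
    (hm : m + f + (r - 1) * (3 * f + 2 * f * f) ≤ δ) :
    (c.level δ r).card * m ^ (2 * r) ≤ Fintype.card V ^ 2 + (c.level δ r).card *
      (2 * (f * (2 * (r * Δ ^ (r - 1))) * Δ ^ r) +
        f * ((r + 1) ^ 2 * ((f + 1) * ((r + 2) * (r + 1))) ^ r * Δ ^ (r - 1)) ^ 2) := by
  classical
  set M := 2 * (f * (2 * (r * Δ ^ (r - 1))) * Δ ^ r) +
        f * ((r + 1) ^ 2 * ((f + 1) * ((r + 2) * (r + 1))) ^ r * Δ ^ (r - 1)) ^ 2 with hM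
  set R : Sym2 V → V × V → Prop := fun e st => ∃ e' ∈ X.edgeSet, c.rank e' < c.rank e ∧
      st ∈ c.pairs e' with hR
  have h1 : ∀ e ∈ c.level δ r, m ^ (2 * r) ≤ ((c.pairs e).filter fun st => ¬ R e st).card + M := by
    intro e he
    have h := c.card_repeated_pairs_le hΔ hΔ0 (c.mem_edgeSet_of_mem_level he)
    have h2 := Finset.card_filter_add_card_filter_not (s := c.pairs e) (R e)
    have h3 : m ^ (2 * r) ≤ (c.pairs e).card := by
      rw [pairs, Finset.card_product, two_mul, pow_add]
      exact Nat.mul_le_mul (c.pow_le_card_armEnds hm he (Sym2.out_fst_mem e))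
        (c.pow_le_card_armEnds hm he (Sym2.out_snd_mem e))
    have h4 : ((c.pairs e).filter (R e)).card ≤ M := by convert h
    omega
  -- Each pair is charged to the lightest edge of the graph that has it, so the sets of unrepeated
  -- pairs are disjoint.
  have h2 : ∑ e ∈ c.level δ r, ((c.pairs e).filter fun st => ¬ R e st).card ≤
      Fintype.card V ^ 2 := by
    rw [← Finset.card_biUnion]
    · refine (Finset.card_le_univ _).trans ?_
      rw [Fintype.card_prod, sq]
    · intro e he e' he' hne
      rw [Function.onFun, Finset.disjoint_left]
      intro st h h'
      obtain ⟨h1, h2⟩ := Finset.mem_filter.1 h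
      obtain ⟨h1', h2'⟩ := Finset.mem_filter.1 h'
      have hE := c.mem_edgeSet_of_mem_level he
      have hE' := c.mem_edgeSet_of_mem_level he'
      rcases lt_trichotomy (c.rank e) (c.rank e') with hlt | heq | hlt
      · exact h2' ⟨e, hE, hlt, h1⟩
      · exact hne (c.rank_inj hE hE' heq)
      · exact h2 ⟨e', hE', hlt, h1'⟩
  calc (c.level δ r).card * m ^ (2 * r) = ∑ e ∈ c.level δ r, m ^ (2 * r) := by simp
    _ ≤ ∑ e ∈ c.level δ r, (((c.pairs e).filter fun st => ¬ R e st).card + M) :=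
      Finset.sum_le_sum h1
    _ = (∑ e ∈ c.level δ r, ((c.pairs e).filter fun st => ¬ R e st).card) +
        (c.level δ r).card * M := by rw [Finset.sum_add_distrib]; simp
    _ ≤ _ := by gcongr

end FaultConfig

/-! ### Weighted distances and emulators -/

variable {V : Type u}

theorem walkWeight_append {G : SimpleGraph V} (w : Sym2 V → ℝ≥0∞) {a b d : V} (p : G.Walk a b)
    (q : G.Walk b d) : walkWeight w (p.append q) = walkWeight w p + walkWeight w q := by
  simp [walkWeight]

theorem walkWeight_cons {G : SimpleGraph V} (w : Sym2 V → ℝ≥0∞) {a b d : V} (h : G.Adj a b)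
    (q : G.Walk b d) : walkWeight w (q.cons h) = w s(a, b) + walkWeight w q := by
  simp [walkWeight]

theorem walkWeight_transfer {G G' : SimpleGraph V} (w : Sym2 V → ℝ≥0∞) {a b : V} (p : G.Walk a b)
    (h : ∀ e ∈ p.edges, e ∈ G'.edgeSet) : walkWeight w (p.transfer G' h) = walkWeight w p := by
  simp [walkWeight]

theorem walkWeight_le {G : SimpleGraph V} {w : Sym2 V → ℝ≥0∞} {a b : V} (p : G.Walk a b) {m : ℝ≥0∞}
    (h : ∀ e ∈ p.edges, w e ≤ m) : walkWeight w p ≤ p.length * m := by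
  have := List.sum_le_card_nsmul (p.edges.map w) m (by simpa using h)
  simpa [walkWeight, nsmul_eq_mul] using this

theorem wdist_le {G : SimpleGraph V} (w : Sym2 V → ℝ≥0∞) {a b : V} (p : G.Walk a b) :
    wdist G w a b ≤ walkWeight w p :=
  iInf_le _ p

theorem wdist_self (G : SimpleGraph V) (w : Sym2 V → ℝ≥0∞) (a : V) : wdist G w a a = 0 :=
  le_antisymm ((wdist_le w .nil).trans (by simp [walkWeight])) zero_le

theorem wdist_triangle (G : SimpleGraph V) (w : Sym2 V → ℝ≥0∞) (a b d : V) :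
    wdist G w a d ≤ wdist G w a b + wdist G w b d := by
  refine ENNReal.le_iInf_add_iInf fun p q => ?_
  rw [← walkWeight_append]
  exact wdist_le w _

theorem wdist_le_of_adj {G : SimpleGraph V} (w : Sym2 V → ℝ≥0∞) {a b : V} (h : G.Adj a b) :
    wdist G w a b ≤ w s(a, b) :=
  (wdist_le w h.toWalk).trans (by simp [walkWeight])

theorem wdist_anti {G G' : SimpleGraph V} (h : G ≤ G') (w : Sym2 V → ℝ≥0∞) (a b : V) :
    wdist G' w a b ≤ wdist G w a b :=
  le_iInf fun p => (wdist_le w (p.transfer G' fun _ he =>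
    SimpleGraph.edgeSet_mono h (p.edges_subset_edgeSet he))).trans_eq (walkWeight_transfer w p _)

theorem emulatorWeight_le {G : SimpleGraph V} (w : Sym2 V → ℝ≥0∞) {e : Sym2 V}
    (he : e ∈ G.edgeSet) : emulatorWeight G w e ≤ w e := by
  induction e with
  | _ a b => exact wdist_le_of_adj w he

theorem wdist_le_wdist_emulator (G H : SimpleGraph V) (w : Sym2 V → ℝ≥0∞) (a b : V) :
    wdist G w a b ≤ wdist H (emulatorWeight G w) a b := by
  refine le_iInf fun p => ?_
  induction p with
  | nil => simp [wdist_self]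
  | @cons a x b h p ih =>
    rw [walkWeight_cons]
    exact (wdist_triangle G w a x b).trans (add_le_add le_rfl ih)

/-- A graph that approximates the distances along edges is an emulator. -/
theorem isEmulator_of_adj {G H : SimpleGraph V} {w : Sym2 V → ℝ≥0∞} {t : ℝ≥0} (ht : t ≠ 0)
    (h : ∀ a b, G.Adj a b → wdist H (emulatorWeight G w) a b ≤ t * w s(a, b)) :
    IsEmulator G w t H := by
  refine fun a b => ⟨wdist_le_wdist_emulator G H w a b, ?_⟩
  -- The infimum may be empty, and `0 * ∞ = 0`; hence the need for `t ≠ 0`.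
  rw [wdist, wdist, ENNReal.mul_iInf_of_ne (by simpa using ht) ENNReal.coe_ne_top]
  refine le_iInf fun p => ?_
  change wdist H (emulatorWeight G w) a b ≤ _
  induction p with
  | nil => simp [wdist_self]
  | @cons a x b hadj p ih =>
    rw [walkWeight_cons, mul_add]
    exact (wdist_triangle _ _ a x b).trans (add_le_add (h a x hadj) ih)

theorem isEFTEmulator_top (G : SimpleGraph V) (w : Sym2 V → ℝ≥0) (f : ℕ) {t : ℝ≥0} (ht : 1 ≤ t) :
    IsEFTEmulator G w f t ⊤ := by
  intro F _ _
  refine isEmulator_of_adj (by positivity) fun a b hab => ?_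
  calc _ ≤ emulatorWeight (G.deleteEdges F) (fun e => (w e : ℝ≥0∞)) s(a, b) :=
        wdist_le_of_adj _ (by simpa using hab.ne)
    _ ≤ w s(a, b) := emulatorWeight_le (fun e => (w e : ℝ≥0∞)) hab
    _ ≤ t * w s(a, b) := le_mul_of_one_le_left zero_le (by exact_mod_cast ht)

/-- Ties between equal weights are broken lexicographically by an arbitrary numbering. -/
theorem exists_rank [Fintype V] (w : Sym2 V → ℝ≥0) :
    ∃ rk : Sym2 V → ℕ, Function.Injective rk ∧ ∀ e e', rk e < rk e' → w e ≤ w e' := by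
  classical
  let key : Sym2 V → ℝ≥0 ×ₗ Fin (Fintype.card (Sym2 V)) :=
    fun e => toLex (w e, Fintype.equivFin _ e)
  have hkey : Function.Injective key := fun e e' h => by
    have := congrArg (fun x => (ofLex x).2) h
    simpa [key] using this
  let rk : Sym2 V → ℕ := fun e => (Finset.univ.filter fun g => key g < key e).card
  have hmono : ∀ e e', key e < key e' → rk e < rk e' := fun e e' h => by
    refine Finset.card_lt_card ⟨fun g hg => ?_, fun hsub => ?_⟩
    · exact Finset.mem_filter.2 ⟨Finset.mem_univ _, (Finset.mem_filter.1 hg).2.trans h⟩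
    · exact lt_irrefl _ (Finset.mem_filter.1
        (hsub (Finset.mem_filter.2 ⟨Finset.mem_univ e, h⟩))).2
  refine ⟨rk, fun e e' h => ?_, fun e e' h => ?_⟩
  · rcases lt_trichotomy (key e) (key e') with hlt | heq | hlt
    · exact absurd h (hmono _ _ hlt).ne
    · exact hkey heq
    · exact absurd h (hmono _ _ hlt).ne'
  · rcases lt_trichotomy (key e) (key e') with hlt | heq | hlt
    · rcases (Prod.Lex.toLex_lt_toLex).1 hlt with h' | h'
      exacts [h'.le, h'.1.le]
    · exact (congrArg (fun x => w x) (hkey heq)).le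
    · exact absurd h (hmono _ _ hlt).le.not_gt

/-! ### The greedy graph and its obstructions -/

/-- The edge `e` has no short replacement in `S` after deletion of the edges in `F`. -/
def IsObstruction (G : SimpleGraph V) (w : Sym2 V → ℝ≥0) (f : ℕ) (t : ℝ≥0) (S : Set (Sym2 V))
    (e : Sym2 V) (F : Finset (Sym2 V)) : Prop :=
  (F : Set (Sym2 V)) ⊆ G.edgeSet ∧ F.card ≤ f ∧ e ∉ F ∧ ∃ a b, s(a, b) = e ∧
    (t : ℝ≥0∞) * w e < wdist (SimpleGraph.fromEdgeSet S)
      (emulatorWeight (G.deleteEdges (F : Set (Sym2 V))) fun e => (w e : ℝ≥0∞)) a b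

/-- The edges of rank less than `n` that the greedy algorithm chooses. -/
def greedy (G : SimpleGraph V) (w : Sym2 V → ℝ≥0) (f : ℕ) (t : ℝ≥0) (rk : Sym2 V → ℕ) :
    ℕ → Set (Sym2 V)
  | 0 => ∅
  | n + 1 => greedy G w f t rk n ∪ {e | e ∈ G.edgeSet ∧ rk e = n ∧
      ∃ F, IsObstruction G w f t (greedy G w f t rk n) e F}

section Greedy

variable {G : SimpleGraph V} {w : Sym2 V → ℝ≥0} {f : ℕ} {t : ℝ≥0} {rk : Sym2 V → ℕ}

theorem mem_greedy_iff {n : ℕ} {e : Sym2 V} : e ∈ greedy G w f t rk n ↔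
    e ∈ G.edgeSet ∧ rk e < n ∧ ∃ F, IsObstruction G w f t (greedy G w f t rk (rk e)) e F := by
  induction n with
  | zero => simp [greedy]
  | succ n ih =>
    rw [greedy, Set.mem_union, ih]
    constructor
    · rintro (⟨h1, h2, h3⟩ | ⟨h1, rfl, h3⟩)
      exacts [⟨h1, by omega, h3⟩, ⟨h1, by omega, h3⟩]
    · rintro ⟨h1, h2, h3⟩
      rcases Nat.lt_succ_iff_lt_or_eq.1 h2 with h | h
      · exact Or.inl ⟨h1, h, h3⟩
      · exact Or.inr ⟨h1, h, by rwa [h] at h3⟩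

variable (G w f t rk) in
/-- The graph that the greedy algorithm chooses. -/
def greedyGraph : SimpleGraph V :=
  SimpleGraph.fromEdgeSet {e | e ∈ G.edgeSet ∧
    ∃ F, IsObstruction G w f t (greedy G w f t rk (rk e)) e F}

theorem mem_edgeSet_greedyGraph {e : Sym2 V} : e ∈ (greedyGraph G w f t rk).edgeSet ↔
    e ∈ G.edgeSet ∧ ∃ F, IsObstruction G w f t (greedy G w f t rk (rk e)) e F := by
  rw [greedyGraph, SimpleGraph.edgeSet_fromEdgeSet]
  refine ⟨fun h => h.1, fun h => ⟨h, G.not_isDiag_of_mem_edgeSet h.1⟩⟩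

theorem mem_fromEdgeSet_greedy {e : Sym2 V} {n : ℕ} (he : e ∈ (greedyGraph G w f t rk).edgeSet)
    (hn : rk e < n) : e ∈ (SimpleGraph.fromEdgeSet (greedy G w f t rk n)).edgeSet := by
  rw [SimpleGraph.edgeSet_fromEdgeSet]
  have h := mem_edgeSet_greedyGraph.1 he
  exact ⟨mem_greedy_iff.2 ⟨h.1, hn, h.2⟩, G.not_isDiag_of_mem_edgeSet h.1⟩

/-- If a rejected edge survives `F`, then `F` was no obstruction to it, so the edges chosen before
it already give the stretch; later edges only shorten distances. -/
theorem isEFTEmulator_greedyGraph (ht : 1 ≤ t) :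
    IsEFTEmulator G w f t (greedyGraph G w f t rk) := by
  intro F hF hcard
  refine isEmulator_of_adj (by positivity) fun a b hab => ?_
  have habG := SimpleGraph.deleteEdges_adj.1 hab
  by_cases he : s(a, b) ∈ (greedyGraph G w f t rk).edgeSet
  · calc _ ≤ emulatorWeight (G.deleteEdges F) (fun e => (w e : ℝ≥0∞)) s(a, b) :=
          wdist_le_of_adj _ he
      _ ≤ w s(a, b) := emulatorWeight_le (fun e => (w e : ℝ≥0∞)) hab
      _ ≤ t * w s(a, b) := le_mul_of_one_le_left zero_le (by exact_mod_cast ht)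
  · by_contra! hlt
    refine he (mem_edgeSet_greedyGraph.2 ⟨habG.1, F, hF, hcard, habG.2, a, b, rfl,
      hlt.trans_le (wdist_anti ?_ _ a b)⟩)
    refine SimpleGraph.fromEdgeSet_mono fun e he => ?_
    have := mem_greedy_iff.1 he
    exact ⟨this.1, this.2.2⟩

/-- Short detours in the greedy graph meet the obstructions. -/
theorem lt_walkWeight_of_isObstruction {x y : V} {F : Finset (Sym2 V)}
    (hF : IsObstruction G w f t (greedy G w f t rk (rk s(x, y))) s(x, y) F)
    (p : (greedyGraph G w f t rk).Walk x y) (hp : ∀ g ∈ p.edges, rk g < rk s(x, y)) :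
    (t : ℝ≥0∞) * w s(x, y) < walkWeight (emulatorWeight (G.deleteEdges (F : Set (Sym2 V)))
      fun e => (w e : ℝ≥0∞)) p := by
  obtain ⟨-, -, -, a, b, hab, hlt⟩ := hF
  have hlt' : (t : ℝ≥0∞) * w s(x, y) < wdist (SimpleGraph.fromEdgeSet
      (greedy G w f t rk (rk s(x, y)))) (emulatorWeight (G.deleteEdges (F : Set (Sym2 V)))
        fun e => (w e : ℝ≥0∞)) x y := by
    rcases Sym2.eq_iff.1 hab with ⟨rfl, rfl⟩ | ⟨rfl, rfl⟩
    · exact hlt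
    · rwa [wdist_comm]
  refine hlt'.trans_le ((wdist_le _ (p.transfer _ fun g hg => mem_fromEdgeSet_greedy
    (p.edges_subset_edgeSet hg) (hp g hg))).trans_eq (walkWeight_transfer _ p _))

/-- The edges of a walk that avoids `F` survive in `G \ F`, and their weights there are at most that
of the bypassed edge. -/
theorem isObstruction_hit {r : ℕ} (hw : ∀ e e', rk e < rk e' → w e ≤ w e') {x y : V}
    {F : Finset (Sym2 V)}
    (hF : IsObstruction G w f ((4 * r + 1 : ℕ) : ℝ≥0)
      (greedy G w f ((4 * r + 1 : ℕ) : ℝ≥0) rk (rk s(x, y))) s(x, y) F)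
    (p : (greedyGraph G w f ((4 * r + 1 : ℕ) : ℝ≥0) rk).Walk x y)
    (hp : ∀ g ∈ p.edges, rk g < rk s(x, y)) (hlen : p.length ≤ 4 * r + 1) :
    ∃ g ∈ p.edges, g ∈ F := by
  by_contra! hcon
  refine (lt_walkWeight_of_isObstruction hF p hp).not_ge ((walkWeight_le p
    (m := (w s(x, y) : ℝ≥0∞)) fun g hg => ?_).trans ?_)
  · refine (emulatorWeight_le (fun e => (w e : ℝ≥0∞)) ?_).trans
      (by exact_mod_cast hw _ _ (hp g hg))
    rw [SimpleGraph.edgeSet_deleteEdges]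
    exact ⟨(mem_edgeSet_greedyGraph.1 (p.edges_subset_edgeSet hg)).1, hcon g hg⟩
  · gcongr
    exact_mod_cast hlen

theorem isObstruction_hit_twice {r : ℕ} (hw : ∀ e e', rk e < rk e' → w e ≤ w e') {x y : V}
    (hxy : G.Adj x y) {F : Finset (Sym2 V)}
    (hF : IsObstruction G w f ((4 * r + 1 : ℕ) : ℝ≥0)
      (greedy G w f ((4 * r + 1 : ℕ) : ℝ≥0) rk (rk s(x, y))) s(x, y) F)
    (p : (greedyGraph G w f ((4 * r + 1 : ℕ) : ℝ≥0) rk).Walk x y)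
    (hp : ∀ g ∈ p.edges, rk g < rk s(x, y)) (hlen : p.length ≤ 2 * r + 1) :
    ∃ g ∈ p.edges, ∃ h ∈ p.edges, g ≠ h ∧ g ∈ F ∧ h ∈ F := by
  classical
  by_contra! hcon
  -- On a path the only fault is crossed only once.
  obtain ⟨q, hq⟩ : ∃ q, q = p.bypass := ⟨_, rfl⟩
  have hqp : ∀ g ∈ q.edges, g ∈ p.edges := fun g hg => p.edges_bypass_subset_edges (hq ▸ hg)
  have hqlen : q.length ≤ 2 * r + 1 := hq ▸ p.length_bypass_le_length.trans hlen
  have hqr : ∀ g ∈ q.edges, rk g < rk s(x, y) := fun g hg => hp g (hqp g hg)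
  have hnd : q.edges.Nodup := hq ▸ p.bypass_isPath.isTrail.edges_nodup
  obtain ⟨g, hg, hgF⟩ := isObstruction_hit hw hF q hqr (by omega)
  obtain ⟨a, b, q₁, h, q₂, rfl, rfl⟩ := exists_split_of_mem_edges q hg
  simp only [SimpleGraph.Walk.edges_append, SimpleGraph.Walk.edges_cons] at hnd hqr hqp
  have hnd2 := List.nodup_cons.1 (List.nodup_append.1 hnd).2.1
  have hout : ∀ g, g ∈ q₁.edges ∨ g ∈ q₂.edges →
      g ∈ (G.deleteEdges (F : Set (Sym2 V))).edgeSet ∧ (w g : ℝ≥0∞) ≤ w s(x, y) := by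
    intro g hg
    have hmem : g ∈ q₁.edges ++ s(a, b) :: q₂.edges := by
      rcases hg with hg | hg <;> simp [hg]
    have hne : g ≠ s(a, b) := by
      rintro rfl
      rcases hg with hg | hg
      · exact List.disjoint_of_nodup_append hnd hg (by simp)
      · exact hnd2.1 hg
    have hgF' : g ∉ F := fun hgF' => hcon g (hqp g hmem) s(a, b) (hqp _ (by simp)) hne hgF' hgF
    have hgH : g ∈ (greedyGraph G w f ((4 * r + 1 : ℕ) : ℝ≥0) rk).edgeSet := by
      rcases hg with hg | hg
      exacts [q₁.edges_subset_edgeSet hg, q₂.edges_subset_edgeSet hg]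
    refine ⟨?_, by exact_mod_cast hw _ _ (hqr g hmem)⟩
    rw [SimpleGraph.edgeSet_deleteEdges]
    exact ⟨(mem_edgeSet_greedyGraph.1 hgH).1, hgF'⟩
  have hxy' : (G.deleteEdges (F : Set (Sym2 V))).Adj x y :=
    SimpleGraph.deleteEdges_adj.2 ⟨hxy, hF.2.2.1⟩
  set W : Sym2 V → ℝ≥0∞ := fun e => (w e : ℝ≥0∞) with hW
  -- The faulty edge is bypassed in `G \ F` by the rest of the path and `s(x, y)`, which is not in
  -- `F`. With `i` edges besides the fault, the path weighs at most `i + (i + 1) ≤ 4 * r + 1` times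
  -- the weight of `s(x, y)`.
  have hdet : emulatorWeight (G.deleteEdges (F : Set (Sym2 V))) W s(a, b) ≤
      ((q₁.length + (q₂.length + 1) : ℕ) : ℝ≥0∞) * w s(x, y) := by
    change wdist _ _ a b ≤ _
    refine (wdist_le W ((q₁.reverse.transfer _ fun g hg => (hout g (Or.inl (by simpa using hg))).1
      ).append ((q₂.reverse.transfer _ fun g hg => (hout g (Or.inr (by simpa using hg))).1
      ).cons hxy'))).trans ((walkWeight_le _ (m := (w s(x, y) : ℝ≥0∞)) fun g hg => ?_).trans ?_)
    · simp only [SimpleGraph.Walk.edges_append, SimpleGraph.Walk.edges_cons, List.mem_append,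
        List.mem_cons, SimpleGraph.Walk.edges_transfer, SimpleGraph.Walk.edges_reverse,
        List.mem_reverse] at hg
      rcases hg with hg | rfl | hg
      exacts [(hout g (Or.inl hg)).2, le_rfl, (hout g (Or.inr hg)).2]
    · simp
  have harms : ∀ g, g ∈ q₁.edges ∨ g ∈ q₂.edges →
      emulatorWeight (G.deleteEdges (F : Set (Sym2 V))) W g ≤ w s(x, y) := fun g hg =>
    (emulatorWeight_le W (hout g hg).1).trans (hout g hg).2
  refine (lt_walkWeight_of_isObstruction hF (q₁.append (q₂.cons h)) (by simpa using hqr)).not_ge ?_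
  rw [walkWeight_append, walkWeight_cons]
  calc _ ≤ (q₁.length : ℝ≥0∞) * w s(x, y) + (((q₁.length + (q₂.length + 1) : ℕ) : ℝ≥0∞) *
        w s(x, y) + (q₂.length : ℝ≥0∞) * w s(x, y)) := by
        gcongr
        · exact walkWeight_le q₁ fun g hg => harms g (Or.inl hg)
        · exact walkWeight_le q₂ fun g hg => harms g (Or.inr hg)
    _ = ((q₁.length + ((q₁.length + (q₂.length + 1)) + q₂.length) : ℕ) : ℝ≥0∞) * w s(x, y) := by
        push_cast
        ring
    _ ≤ _ := by
        gcongr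
        simp only [SimpleGraph.Walk.length_append, SimpleGraph.Walk.length_cons] at hqlen
        exact_mod_cast (by omega : q₁.length + ((q₁.length + (q₂.length + 1)) + q₂.length) ≤
          4 * r + 1)

/-- The greedy graph with its obstructions. -/
theorem exists_faultConfig_greedyGraph {r : ℕ} (hrk : Function.Injective rk)
    (hw : ∀ e e', rk e < rk e' → w e ≤ w e') :
    Nonempty (FaultConfig (greedyGraph G w f ((4 * r + 1 : ℕ) : ℝ≥0) rk) r f) := by
  classical
  have h : ∀ e, ∃ F : Finset (Sym2 V), F.card ≤ f ∧ e ∉ F ∧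
      (e ∈ (greedyGraph G w f ((4 * r + 1 : ℕ) : ℝ≥0) rk).edgeSet →
        IsObstruction G w f ((4 * r + 1 : ℕ) : ℝ≥0)
          (greedy G w f ((4 * r + 1 : ℕ) : ℝ≥0) rk (rk e)) e F) := by
    intro e
    by_cases he : e ∈ (greedyGraph G w f ((4 * r + 1 : ℕ) : ℝ≥0) rk).edgeSet
    · obtain ⟨-, F, hF⟩ := mem_edgeSet_greedyGraph.1 he
      exact ⟨F, hF.2.1, hF.2.2.1, fun _ => hF⟩
    · exact ⟨∅, by simp, by simp, fun h => absurd h he⟩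
  choose F h1 h2 h3 using h
  exact ⟨⟨rk, hrk.injOn, F, h1, h2,
    fun x y hxy p hp hlen => isObstruction_hit hw (h3 _ hxy) p hp hlen,
    fun x y hxy p hp hlen => isObstruction_hit_twice hw
      (mem_edgeSet_greedyGraph.1 (SimpleGraph.mem_edgeSet _ |>.2 hxy)).1
      (h3 _ hxy) p hp hlen⟩⟩

end Greedy

/-! ### Splitting vertices to bound the degree -/

/-- The graph that arises by splitting each vertex into copies, where `B a b` is the copy of `a`
that keeps the edge to `b`. -/
def splitGraph {V : Type u} (H : SimpleGraph V) {ι : V → Type} (B : ∀ a : V, V → ι a) :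
    SimpleGraph (Σ a, ι a) where
  Adj x y := H.Adj x.1 y.1 ∧ x.2 = B x.1 y.1 ∧ y.2 = B y.1 x.1
  symm := ⟨fun _ _ h => ⟨h.1.symm, h.2.2, h.2.1⟩⟩
  loopless := ⟨fun _ h => h.1.ne rfl⟩

section Split

variable {V : Type u} {H : SimpleGraph V} {ι : V → Type} {B : ∀ a : V, V → ι a}

variable (H B) in
/-- The projection of the split graph. -/
def splitHom : splitGraph H B →g H := ⟨Sigma.fst, fun h => h.1⟩

/-- An edge of `H` determines, through `B`, which copies of its ends it joins. -/
theorem injOn_splitHom : Set.InjOn (Sym2.map (splitHom H B)) (splitGraph H B).edgeSet := by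
  intro e he e' he' h
  induction e with
  | _ x y =>
  induction e' with
  | _ x' y' =>
  obtain ⟨a, i⟩ := x
  obtain ⟨b, j⟩ := y
  obtain ⟨a', i'⟩ := x'
  obtain ⟨b', j'⟩ := y'
  obtain ⟨-, hi, hj⟩ := he
  obtain ⟨-, hi', hj'⟩ := he'
  simp only at hi hj hi' hj'
  subst hi hj hi' hj'
  rw [Sym2.map_mk, Sym2.map_mk] at h
  rcases Sym2.eq_iff.1 h with ⟨h1, h2⟩ | ⟨h1, h2⟩
  · change a = a' at h1
    change b = b' at h2
    subst h1 h2
    rfl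
  · change a = b' at h1
    change b = a' at h2
    subst h1 h2
    exact Sym2.eq_swap

/-- Fault configurations lift to split graphs. -/
theorem FaultConfig.nonempty_split {r f : ℕ} (c : FaultConfig H r f) [Finite (Σ a, ι a)] :
    Nonempty (FaultConfig (splitGraph H B) r f) := by
  classical
  have := Fintype.ofFinite (Σ a, ι a)
  set φ := splitHom H B with hφ
  have hadj : ∀ x y, (splitGraph H B).Adj x y → H.Adj (φ x) (φ y) := fun x y h => φ.map_adj h
  have hE : ∀ e ∈ (splitGraph H B).edgeSet, Sym2.map φ e ∈ H.edgeSet := fun e he => by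
    induction e with
    | _ x y => exact hadj x y he
  -- Faults are the edges over faults; by injectivity there are no more of them. Walks project with
  -- the same length, so both hitting properties lift.
  set F : Sym2 (Σ a, ι a) → Finset (Sym2 (Σ a, ι a)) := fun e =>
    (splitGraph H B).edgeFinset.filter fun g => Sym2.map φ g ∈ c.F (Sym2.map φ e) with hF
  have hmem : ∀ {x y} (p : (splitGraph H B).Walk x y) {e g}, g ∈ p.edges →
      Sym2.map φ g ∈ c.F (Sym2.map φ e) → g ∈ F e := fun p e g hg h =>
    Finset.mem_filter.2 ⟨by simpa using p.edges_subset_edgeSet hg, h⟩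
  refine ⟨⟨fun e => c.rank (Sym2.map φ e), ?_, F, ?_, ?_, ?_, ?_⟩⟩
  · intro e he e' he' h
    exact injOn_splitHom he he' (c.rank_inj (hE e he) (hE e' he') h)
  · intro e
    refine le_trans (Finset.card_le_card_of_injOn (Sym2.map φ)
      (fun g hg => (Finset.mem_filter.1 hg).2) ?_) (c.card_F (Sym2.map φ e))
    intro g hg g' hg' h
    refine injOn_splitHom ?_ ?_ h
    · simpa using (Finset.mem_filter.1 hg).1
    · simpa using (Finset.mem_filter.1 hg').1
  · intro e he
    exact c.notMem_F _ (Finset.mem_filter.1 he).2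
  · intro x y hxy p hp hlen
    obtain ⟨g, hg, hgF⟩ := c.hit (φ x) (φ y) (hadj x y hxy) (p.map φ)
      (by
        intro g hg
        rw [SimpleGraph.Walk.edges_map] at hg
        obtain ⟨g', hg', rfl⟩ := List.mem_map.1 hg
        exact hp g' hg')
      (by simpa using hlen)
    rw [SimpleGraph.Walk.edges_map] at hg
    obtain ⟨g, hgp, rfl⟩ := List.mem_map.1 hg
    exact ⟨g, hgp, hmem p hgp hgF⟩
  · intro x y hxy p hp hlen
    obtain ⟨g, hg, g', hg', hne, hgF, hgF'⟩ := c.hit_twice (φ x) (φ y) (hadj x y hxy) (p.map φ)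
      (by
        intro g hg
        rw [SimpleGraph.Walk.edges_map] at hg
        obtain ⟨g', hg', rfl⟩ := List.mem_map.1 hg
        exact hp g' hg')
      (by simpa using hlen)
    rw [SimpleGraph.Walk.edges_map] at hg hg'
    obtain ⟨g, hgp, rfl⟩ := List.mem_map.1 hg
    obtain ⟨g', hgp', rfl⟩ := List.mem_map.1 hg'
    exact ⟨g, hgp, g', hgp', fun h => hne (by rw [h]), hmem p hgp hgF, hmem p hgp' hgF'⟩

theorem edgeSet_subset_image_splitHom :
    H.edgeSet ⊆ Sym2.map (splitHom H B) '' (splitGraph H B).edgeSet := by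
  intro e he
  induction e with
  | _ a b =>
    exact ⟨s(⟨a, B a b⟩, ⟨b, B b a⟩), ⟨he, rfl, rfl⟩, rfl⟩

end Split

/-- Every fault configuration has a split of bounded degree on few vertices. -/
theorem FaultConfig.exists_bounded_degree {V : Type u} [Fintype V] {H : SimpleGraph V} {r f : ℕ}
    (c : FaultConfig H r f) {Δ : ℕ} (hΔ : 0 < Δ) :
    ∃ (W : Type u) (_ : Fintype W) (X : SimpleGraph W), Nonempty (FaultConfig X r f) ∧
      (∀ v, (X.neighborSet v).ncard ≤ Δ) ∧ H.edgeSet.ncard ≤ X.edgeSet.ncard ∧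
      Fintype.card W * Δ ≤ Fintype.card V * Δ + 2 * H.edgeSet.ncard := by
  classical
  have hidx : ∀ a : V, ∃ g : V → ℕ, Set.InjOn g (H.neighborSet a) ∧
      ∀ b ∈ H.neighborSet a, g b < H.degree a := by
    intro a
    refine ⟨fun b => if h : b ∈ H.neighborFinset a then (H.neighborFinset a).equivFin ⟨b, h⟩ else 0,
      ?_, ?_⟩
    · intro b hb d hd h
      have hb : b ∈ H.neighborFinset a := by simpa using hb
      have hd : d ∈ H.neighborFinset a := by simpa using hd
      simp only [hb, hd, dif_pos] at h
      exact congrArg Subtype.val ((H.neighborFinset a).equivFin.injective (Fin.val_injective h))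
    · intro b hb
      have hb : b ∈ H.neighborFinset a := by simpa using hb
      simp only [hb, dif_pos]
      exact Fin.is_lt _
  choose g hginj hglt using hidx
  -- Each copy takes a block of `Δ` consecutive neighbours. The reduction in `Fin.ofNat` has no
  -- effect on neighbours, whose numbers are below the degree.
  let B : ∀ a : V, V → Fin (H.degree a / Δ + 1) := fun a b => Fin.ofNat _ (g a b / Δ)
  have hB : ∀ a, ∀ b ∈ H.neighborSet a, (B a b : ℕ) = g a b / Δ := fun a b hb => by
    simp only [B, Fin.ofNat]
    exact Nat.mod_eq_of_lt (Nat.lt_succ_of_le (Nat.div_le_div_right (hglt a b hb).le))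
  refine ⟨Σ a, Fin (H.degree a / Δ + 1), inferInstance, splitGraph H B, c.nonempty_split, ?_, ?_, ?_⟩
  · rintro ⟨a, i⟩
    have hN : ∀ x ∈ (splitGraph H B).neighborSet ⟨a, i⟩, x.1 ∈ H.neighborSet a ∧
        g a x.1 / Δ = i ∧ x.2 = B x.1 a := by
      rintro ⟨b, j⟩ ⟨h1, h2, h3⟩
      refine ⟨h1, ?_, h3⟩
      rw [← hB a b h1]
      exact (congrArg Fin.val h2).symm
    have h1 : ((splitGraph H B).neighborSet ⟨a, i⟩).ncard ≤
        (Finset.Ico (i * Δ) (i * Δ + Δ) : Finset ℕ).card := by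
      rw [← Set.ncard_coe_finset]
      refine Set.ncard_le_ncard_of_injOn (fun x => g a x.1) ?_ ?_ (Finset.finite_toSet _)
      · intro x hx
        have := (hN x hx).2.1
        rw [Finset.mem_coe, Finset.mem_Ico]
        have h3 := Nat.div_add_mod (g a x.1) Δ
        have h4 := Nat.mod_lt (g a x.1) hΔ
        rw [this, mul_comm] at h3
        omega
      · intro x hx y hy hxy
        obtain ⟨hx1, -, hx2⟩ := hN x hx
        obtain ⟨hy1, -, hy2⟩ := hN y hy
        obtain ⟨x, i⟩ := x
        obtain ⟨y, j⟩ := y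
        have h5 : x = y := hginj a hx1 hy1 hxy
        subst h5
        simp only at hx2 hy2
        rw [hx2, hy2]
    simpa using h1
  · exact (Set.ncard_le_ncard (edgeSet_subset_image_splitHom (B := B)) (Set.toFinite _)).trans
      (Set.ncard_image_le (Set.toFinite _))
  · rw [Fintype.card_sigma, Finset.sum_mul]
    have hE : H.edgeSet.ncard = H.edgeFinset.card := by
      rw [← Set.ncard_coe_finset, SimpleGraph.coe_edgeFinset]
    rw [hE, ← H.sum_degrees_eq_twice_card_edges]
    calc ∑ a, Fintype.card (Fin (H.degree a / Δ + 1)) * Δ ≤ ∑ a, (Δ + H.degree a) := by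
          refine Finset.sum_le_sum fun a _ => ?_
          rw [Fintype.card_fin, add_mul, one_mul, add_comm]
          exact Nat.add_le_add_left (Nat.div_mul_le_self _ _) _
      _ = _ := by rw [Finset.sum_add_distrib]; simp


/-! ### From the pair count to the edge bound -/

theorem FaultConfig.density_bound_of_large {V : Type u} [Fintype V] {H : SimpleGraph V} {r f n q : ℕ}
    (c : FaultConfig H r f) (hr : 1 ≤ r) (hn : Fintype.card V = n) (hn0 : 0 < n)
    (hq : q = H.edgeSet.ncard / n) {A : ℕ} (hA : A = (80 * r) ^ (2 * r))
    (h1 : (400 * r ^ 2 + 16 * A * r) * (f + 1) ≤ q)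
    (h2 : 2 ≤ r → 400 * r ^ 2 * (f + 1) ^ 2 ≤ q)
    (h3 : 4 * A * (r + 1) ^ 4 * ((r + 2) * (r + 1)) ^ (2 * r) * (f + 1) ^ (2 * r + 1) ≤ q ^ 2) :
    q ^ (2 * r + 1) ≤ 200 * A * n := by
  have hr2 : 1 ≤ r ^ 2 := Nat.one_le_pow _ _ hr
  have hA0 : 0 < A := by rw [hA]; positivity
  have hq400 : 400 * r ^ 2 * (f + 1) ≤ q := le_trans (by gcongr; omega) h1
  have hq0 : 0 < q := lt_of_lt_of_le (by positivity) hq400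
  have hm1 : q * n ≤ H.edgeSet.ncard := hq ▸ Nat.div_mul_le_self _ _
  have hm2 : H.edgeSet.ncard ≤ 2 * q * n := by
    have : H.edgeSet.ncard < (q + 1) * n := by
      rw [hq, mul_comm]; exact Nat.lt_mul_div_succ _ hn0
    nlinarith
  obtain ⟨W, _, X, ⟨d⟩, hdeg, hE, hW⟩ := c.exists_bounded_degree hq0
  set N := Fintype.card W with hN
  have hN5 : N ≤ 5 * n := by
    refine Nat.le_of_mul_le_mul_right (hW.trans ?_) hq0
    rw [hn]
    nlinarith
  -- With `N ≤ 5 * n`, the `r` peelings cost at most `q * n / 4` edges, so a quarter of `q * n`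
  -- remains. The gap between `δ` and `m` absorbs the edges discarded while arms grow.
  set δ := q / (20 * r) with hδ
  set m := q / (40 * r) with hm
  have hδ1 : δ * (20 * r) ≤ q := Nat.div_mul_le_self _ _
  have hδ2 : q < (δ + 1) * (20 * r) := by
    rw [mul_comm]; exact Nat.lt_mul_div_succ _ (by omega)
  have hm3 : m * (40 * r) ≤ q := Nat.div_mul_le_self _ _
  have hm4 : q < (m + 1) * (40 * r) := by
    rw [mul_comm]; exact Nat.lt_mul_div_succ _ (by omega)
  have hm5 : q ≤ m * (80 * r) := by
    have h40 : 40 * r ≤ q := by nlinarith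
    have : 1 ≤ m := (Nat.one_le_div_iff (by omega)).2 h40
    nlinarith
  have hbranch : m + f + (r - 1) * (3 * f + 2 * f * f) ≤ δ := by
    have e1 : (r - 1) * (3 * f + 2 * f * f) * (80 * r) ≤ q := by
      rcases Nat.lt_or_ge r 2 with hlt | hge
      · have : r - 1 = 0 := by omega
        simp [this]
      · refine le_trans ?_ (h2 hge)
        calc _ ≤ r * (5 * (f + 1) ^ 2) * (80 * r) := by
              gcongr
              · omega
              · nlinarith
          _ = _ := by ring
    generalize (r - 1) * (3 * f + 2 * f * f) = Z at e1 ⊢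
    have e2 : (f + 1) * (80 * r) ≤ q := by
      refine le_trans ?_ hq400
      calc (f + 1) * (80 * r) = 80 * r * 1 * (f + 1) := by ring
        _ ≤ 400 * r * r * (f + 1) := by gcongr; omega
        _ = _ := by ring
    have e3 : (m + f + 1 + Z) * (80 * r) =
        2 * (m * (40 * r)) + (f + 1) * (80 * r) + Z * (80 * r) := by ring
    have e4 : (δ + 1) * (80 * r) = 4 * ((δ + 1) * (20 * r)) := by ring
    have e5 : (m + f + 1 + Z) * (80 * r) < (δ + 1) * (80 * r) := by omega
    have := Nat.lt_of_mul_lt_mul_right e5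
    omega
  have hlev := d.card_edgeSet_le_level δ r
  rw [← hN] at hlev
  set L := (d.level δ r).card with hL
  have hL4 : q * n ≤ 4 * L := by
    have e1 : r * (N * δ) * 4 ≤ q * n := by
      calc r * (N * δ) * 4 ≤ r * (5 * n * δ) * 4 := by gcongr
        _ = δ * (20 * r) * n := by ring
        _ ≤ q * n := by gcongr
    omega
  have hmain := d.card_level_mul_le hdeg hq0 hbranch
  rw [← hN, ← hL] at hmain
  set M := 2 * (f * (2 * (r * q ^ (r - 1))) * q ^ r) +
        f * ((r + 1) ^ 2 * ((f + 1) * ((r + 2) * (r + 1))) ^ r * q ^ (r - 1)) ^ 2 with hM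
  have hAm : q ^ (2 * r) ≤ A * m ^ (2 * r) := by
    rw [hA, ← mul_pow, mul_comm (80 * r)]
    exact Nat.pow_le_pow_left hm5 _
  obtain ⟨ρ, rfl⟩ : ∃ ρ, r = ρ + 1 := ⟨r - 1, by omega⟩
  simp only [Nat.add_sub_cancel] at hM
  have hM1 : 4 * A * (2 * (f * (2 * ((ρ + 1) * q ^ ρ)) * q ^ (ρ + 1))) ≤ q ^ (2 * (ρ + 1)) := by
    calc _ = (16 * A * (ρ + 1)) * f * (q ^ ρ * q ^ (ρ + 1)) := by ring
      _ ≤ (400 * (ρ + 1) ^ 2 + 16 * A * (ρ + 1)) * (f + 1) * (q ^ ρ * q ^ (ρ + 1)) := by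
        gcongr <;> omega
      _ ≤ q * (q ^ ρ * q ^ (ρ + 1)) := by gcongr
      _ = _ := by ring
  have hM2 : 4 * A * (f * ((ρ + 1 + 1) ^ 2 * ((f + 1) * ((ρ + 1 + 2) * (ρ + 1 + 1))) ^ (ρ + 1) *
      q ^ ρ) ^ 2) ≤ q ^ (2 * (ρ + 1)) := by
    calc _ = 4 * A * (ρ + 1 + 1) ^ 4 * ((ρ + 1 + 2) * (ρ + 1 + 1)) ^ (2 * (ρ + 1)) *
          (f * (f + 1) ^ (2 * (ρ + 1))) * q ^ (2 * ρ) := by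
          rw [mul_pow (f + 1)]
          ring
      _ ≤ 4 * A * (ρ + 1 + 1) ^ 4 * ((ρ + 1 + 2) * (ρ + 1 + 1)) ^ (2 * (ρ + 1)) *
          (f + 1) ^ (2 * (ρ + 1) + 1) * q ^ (2 * ρ) := by
          gcongr
          rw [pow_succ, mul_comm]
          gcongr
          omega
      _ ≤ q ^ 2 * q ^ (2 * ρ) := by gcongr
      _ = _ := by ring
  -- The repeated pairs are at most half of all, by `h1` near faults and by `h3` for common ends.
  -- The factor `A` pays for the passage from `m` to `q`.
  have hMA : 2 * A * M ≤ q ^ (2 * (ρ + 1)) := by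
    have h : ∀ P Q Y : ℕ, 4 * A * P ≤ Y → 4 * A * Q ≤ Y → 2 * A * (P + Q) ≤ Y := by
      intro P Q Y hP hQ
      have : 2 * (2 * A * (P + Q)) = 4 * A * P + 4 * A * Q := by ring
      omega
    rw [hM]
    exact h _ _ _ hM1 hM2
  have hMm : 2 * M ≤ m ^ (2 * (ρ + 1)) := by
    refine Nat.le_of_mul_le_mul_left ?_ hA0
    calc A * (2 * M) = 2 * A * M := by ring
      _ ≤ _ := hMA.trans hAm
  have hfin : L * m ^ (2 * (ρ + 1)) ≤ 2 * N ^ 2 := by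
    have : L * (2 * M) ≤ L * m ^ (2 * (ρ + 1)) := by gcongr
    have h2M : L * (2 * M) = 2 * (L * M) := by ring
    omega
  refine Nat.le_of_mul_le_mul_right ?_ hn0
  calc q ^ (2 * (ρ + 1) + 1) * n = q * n * q ^ (2 * (ρ + 1)) := by ring
    _ ≤ 4 * L * (A * m ^ (2 * (ρ + 1))) := by gcongr
    _ = 4 * A * (L * m ^ (2 * (ρ + 1))) := by ring
    _ ≤ 4 * A * (2 * (5 * n) ^ 2) :=
      Nat.mul_le_mul_left _ (hfin.trans (Nat.mul_le_mul_left 2 (Nat.pow_le_pow_left hN5 2)))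
    _ = 200 * A * n * n := by ring

/-- The average degree of a graph with a fault configuration. -/
theorem FaultConfig.density_bound (r : ℕ) (hr : 1 ≤ r) : ∃ K : ℕ, ∀ {V : Type u} [Fintype V]
    {H : SimpleGraph V} {f n q : ℕ}, FaultConfig H r f → Fintype.card V = n → 0 < n →
      q = H.edgeSet.ncard / n → q ^ 2 ≤ K * (f + 1) ^ (2 * r + 1) ∨ q ^ (2 * r + 1) ≤ K * n := by
  obtain ⟨A, hA⟩ : ∃ A, A = (80 * r) ^ (2 * r) := ⟨_, rfl⟩
  set b := 400 * r ^ 2 + 16 * A * r with hb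
  set e := 4 * A * (r + 1) ^ 4 * ((r + 2) * (r + 1)) ^ (2 * r) with he
  refine ⟨b ^ 2 + e + 200 * A, fun {V _ H f n q} c hn hn0 hq => ?_⟩
  by_contra! hcon
  obtain ⟨hcon1, hcon2⟩ := hcon
  have hf : 1 ≤ f + 1 := by omega
  -- A large `q ^ 2` against `(f + 1) ^ (2 * r + 1)` also gives the linear bound, and the quadratic
  -- one if `r ≥ 2`.
  have key : ∀ i, 2 * i ≤ 2 * r + 1 → b * (f + 1) ^ i ≤ q := by
    intro i hi
    refine le_of_lt (lt_of_pow_lt_pow_left₀ 2 (Nat.zero_le _) (lt_of_le_of_lt ?_ hcon1))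
    rw [mul_pow, ← pow_mul, mul_comm i]
    gcongr
    omega
  refine hcon2.not_ge (le_trans (c.density_bound_of_large hr hn hn0 hq hA ?_ ?_ ?_) ?_)
  · simpa using key 1 (by omega)
  · intro h2
    refine le_trans ?_ (key 2 (by omega))
    gcongr
    omega
  · refine le_trans ?_ hcon1.le
    gcongr
    omega
  · gcongr
    omega

/-- Fault-tolerant emulators of stretch `4 * r + 1`. -/
theorem exists_isEFTEmulator (r : ℕ) (hr : 1 ≤ r) (C : ℝ) : ∃ K : ℝ, ∀ (V : Type u) [Fintype V]
    (G : SimpleGraph V) (w : Sym2 V → ℝ≥0) (f : ℕ),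
      (f : ℝ) ≤ C * (Fintype.card V : ℝ) ^ (2 / ((2 * r + 1 : ℕ) : ℝ) ^ 2) →
        ∃ H : SimpleGraph V, IsEFTEmulator G w f ((4 * r + 1 : ℕ) : ℝ≥0) H ∧
          (H.edgeSet.ncard : ℝ) ≤
            K * (Fintype.card V : ℝ) ^ (1 + 1 / ((2 * r + 1 : ℕ) : ℝ)) := by
  obtain ⟨A, hA⟩ := FaultConfig.density_bound.{u} r hr
  obtain ⟨k, hk⟩ : ∃ k, k = 2 * r + 1 := ⟨_, rfl⟩
  rw [← hk]
  have hk0 : 0 < k := by omega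
  have hkR : (0 : ℝ) < k := by exact_mod_cast hk0
  set D : ℝ := (A : ℝ) * (|C| + 1) ^ k with hD
  have hD0 : 0 ≤ D := by positivity
  refine ⟨Real.sqrt D + (A + 1) + 1, fun V _ G w f hf => ?_⟩
  obtain ⟨rk, hrk, hw⟩ := exists_rank w
  obtain ⟨c⟩ := exists_faultConfig_greedyGraph (G := G) (f := f) (r := r) hrk hw
  refine ⟨greedyGraph G w f _ rk, isEFTEmulator_greedyGraph (by simp), ?_⟩
  set m := (greedyGraph G w f ((4 * r + 1 : ℕ) : ℝ≥0) rk).edgeSet.ncard with hm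
  obtain ⟨n, hn⟩ : ∃ n, Fintype.card V = n := ⟨_, rfl⟩
  rw [hn] at hf ⊢
  rcases Nat.eq_zero_or_pos n with hn0 | hn0
  · have : IsEmpty V := Fintype.card_eq_zero_iff.1 (hn.trans hn0)
    have hm0 : m = 0 := by
      rw [hm, Set.ncard_eq_zero]
      refine Set.eq_empty_of_forall_notMem fun e _ => ?_
      induction e with
      | _ a b => exact IsEmpty.false a
    rw [hm0]
    push_cast
    positivity
  have hnR : (1 : ℝ) ≤ n := by exact_mod_cast hn0
  obtain ⟨q, hq⟩ : ∃ q, q = m / n := ⟨_, rfl⟩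
  set x : ℝ := (n : ℝ) ^ (1 / (k : ℝ)) with hx
  have hx1 : 1 ≤ x := Real.one_le_rpow hnR (by positivity)
  have hxk : x ^ k = n := by
    rw [hx, ← Real.rpow_natCast, ← Real.rpow_mul (by positivity), one_div,
      inv_mul_cancel₀ hkR.ne', Real.rpow_one]
  have hqx : (q : ℝ) ≤ (Real.sqrt D + (A + 1)) * x := by
    rcases hA c hn hn0 hq with h | h
    · rw [← hk] at h
      have h' : (q : ℝ) ^ 2 ≤ A * ((f : ℝ) + 1) ^ k := by exact_mod_cast h
      set y : ℝ := (n : ℝ) ^ (2 / (k : ℝ) ^ 2) with hy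
      have hy1 : 1 ≤ y := Real.one_le_rpow hnR (by positivity)
      -- The origin of the exponent `2 / k ^ 2`: it turns `q ^ 2 = O(y ^ k)` into `q = O(x)`.
      have hyk : y ^ k = x ^ 2 := by
        rw [hx, hy, ← Real.rpow_mul_natCast (by positivity),
          ← Real.rpow_mul_natCast (by positivity)]
        congr 1
        push_cast
        field_simp
      have hfy : (f : ℝ) + 1 ≤ (|C| + 1) * y := by
        have : C * y ≤ |C| * y := by gcongr; exact le_abs_self C
        nlinarith
      have h2 : (q : ℝ) ^ 2 ≤ (Real.sqrt D * x) ^ 2 := by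
        calc (q : ℝ) ^ 2 ≤ A * ((|C| + 1) * y) ^ k := h'.trans (by gcongr)
          _ = D * x ^ 2 := by rw [mul_pow, hyk, hD]; ring
          _ = _ := by rw [mul_pow, Real.sq_sqrt hD0]
      have h3 := le_of_sq_le_sq h2 (by positivity)
      have : 0 ≤ ((A : ℝ) + 1) * x := by positivity
      linarith
    · rw [← hk] at h
      have h' : (q : ℝ) ^ k ≤ A * n := by exact_mod_cast h
      have h2 : (q : ℝ) ^ k ≤ (((A : ℝ) + 1) * x) ^ k := by
        rw [mul_pow, hxk]
        refine h'.trans ?_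
        gcongr
        exact (by linarith : (A : ℝ) ≤ A + 1).trans (le_self_pow₀ (by linarith [Nat.cast_nonneg (α := ℝ) A]) hk0.ne')
      have h3 := le_of_pow_le_pow_left₀ hk0.ne' (by positivity) h2
      have : 0 ≤ Real.sqrt D * x := by positivity
      linarith
  have hmq : (m : ℝ) ≤ (q + 1) * n := by
    have : m < n * (q + 1) := hq ▸ Nat.lt_mul_div_succ _ hn0
    rw [mul_comm]
    exact_mod_cast this.le
  rw [Real.rpow_add (by positivity), Real.rpow_one, ← hx]
  calc (m : ℝ) ≤ (q + 1) * n := hmq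
    _ ≤ ((Real.sqrt D + (A + 1)) * x + 1 * x) * n := by
      gcongr
      linarith
    _ = _ := by ring

theorem exists_isEFTEmulator_one (V : Type u) [Fintype V] (G : SimpleGraph V) (w : Sym2 V → ℝ≥0)
    (f : ℕ) : ∃ H : SimpleGraph V, IsEFTEmulator G w f 1 H ∧
      (H.edgeSet.ncard : ℝ) ≤ 1 * (Fintype.card V : ℝ) ^ (2 : ℝ) := by
  classical
  refine ⟨⊤, isEFTEmulator_top G w f le_rfl, ?_⟩
  have h : (⊤ : SimpleGraph V).edgeSet.ncard ≤ Fintype.card V ^ 2 := by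
    rw [← SimpleGraph.coe_edgeFinset, Set.ncard_coe_finset]
    exact SimpleGraph.card_edgeFinset_le_card_choose_two.trans (Nat.choose_le_pow _ _)
  rw [one_mul, Real.rpow_two]
  exact_mod_cast h

end EFT

theorem mainTheorem3 :
    (∀ C : ℝ, ∃ K : ℝ, ∀ (V : Type u) [Fintype V] (G : SimpleGraph V) (w : Sym2 V → ℝ≥0) (f : ℕ),
      (f : ℝ) ≤ C * (Fintype.card V : ℝ) ^ (2 / 9 : ℝ) →
        ∃ H : SimpleGraph V, EFT.IsEFTEmulator G w f 5 H ∧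
          (H.edgeSet.ncard : ℝ) ≤ K * (Fintype.card V : ℝ) ^ (4 / 3 : ℝ)) ∧
    (∀ k : ℕ, Odd k → ∀ C : ℝ, ∃ K : ℝ,
      ∀ (V : Type u) [Fintype V] (G : SimpleGraph V) (w : Sym2 V → ℝ≥0) (f : ℕ),
        (f : ℝ) ≤ C * (Fintype.card V : ℝ) ^ (2 / ((k : ℝ) * ((k : ℝ) + 1))) →
          ∃ H : SimpleGraph V, EFT.IsEFTEmulator G w f ((2 * k - 1 : ℕ) : ℝ≥0) H ∧
            (H.edgeSet.ncard : ℝ) ≤ K * (Fintype.card V : ℝ) ^ (1 + 1 / (k : ℝ))) := by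
  refine ⟨fun C => ?_, fun k hk C => ?_⟩
  · obtain ⟨K, hK⟩ := EFT.exists_isEFTEmulator.{u} 1 le_rfl C
    refine ⟨K, fun V _ G w f hf => ?_⟩
    obtain ⟨H, h1, h2⟩ := hK V G w f (by convert hf using 3; norm_num)
    refine ⟨H, by simpa using h1, ?_⟩
    convert h2 using 3
    norm_num
  · obtain ⟨r, rfl⟩ := hk
    rcases Nat.eq_zero_or_pos r with rfl | hr
    · refine ⟨1, fun V _ G w f _ => ?_⟩
      obtain ⟨H, h1, h2⟩ := EFT.exists_isEFTEmulator_one V G w f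
      refine ⟨H, by simpa using h1, ?_⟩
      convert h2 using 3
      norm_num
    -- The exponent is about to grow to `2 / k ^ 2`, which needs a nonnegative constant.
    · obtain ⟨K, hK⟩ := EFT.exists_isEFTEmulator.{u} r hr |C|
      refine ⟨K, fun V _ G w f hf => ?_⟩
      have e1 : 2 * (2 * r + 1) - 1 = 4 * r + 1 := by omega
      rw [e1]
      refine hK V G w f (hf.trans ?_)
      rcases Nat.eq_zero_or_pos (Fintype.card V) with h0 | h0
      · rw [h0, Nat.cast_zero, Real.zero_rpow (by positivity), Real.zero_rpow (by positivity)]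
        simp
      · have hn : (1 : ℝ) ≤ Fintype.card V := by exact_mod_cast h0
        refine mul_le_mul (le_abs_self C) (Real.rpow_le_rpow_of_exponent_le hn ?_) (by positivity)
          (abs_nonneg C)
        rw [sq]
        gcongr
        linarith
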